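/- Let $\mathbb A$ be a finite-dimensional real alternative $*$-algebra with unit (not necessarily associative), with anti-involution $a\mapsto a^c$. Put $\mathbb S_{\mathbb A}=\{x: x+x^c=0,\ xx^c=1\}$ and $Q_{\mathbb A}=\mathbb R\cup\{x: x+x^c\in\mathbb R,\ xx^c\in\mathbb R,\ 4xx^c>(x+x^c)^2\}$. Let $M\subseteq\mathbb A$ be a hypercomplex subspace, i.e. a real subspace with $\mathbb R\subsetneq M\subseteq Q_{\mathbb A}$, with a hypercomplex basis $(v_0,\dots,v_m)$: $m\ge 1$, $v_0=1$, $v_s\in\mathbb S_{\mathbb A}$ for $s\geq 1$, and $v_sv_t=-v_tv_s$ for distinct $s,t\ge1$. Fix $0\le p<m$, put $q=m-p$, identify $(x_0,\dots,x_m)$ with $\sum_s x_sv_s\in M$, so that $M=\mathbb R^{p+1}\oplus\mathbb R^{q}$, and let $\mathbb S=\{\sum_{s=p+1}^m x_sv_s:\sum_{s=p+1}^m x_s^2=1\}$. Write $\mathbf x_p=\sum_{s=0}^p x_sv_s$, $D_{\mathbf x_p}=\sum_{s=0}^p v_s\partial_{x_s}$ (acting from the left) and $\Delta_{\mathbf x_p}=\sum_{s=0}^p\partial_{x_s}^2$.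 A function $f:M\to\mathbb A$ is called (left) generalized partial-slice monogenic of type $(p,q)$ if for every $\underline\omega\in\mathbb S$ the function $(\mathbf x_p,r)\mapsto f(\mathbf x_p+r\underline\omega)$ is of class $C^1$ on $\mathbb R^{p+2}$ and satisfies $(D_{\mathbf x_p}+\underline\omega\,\partial_r)f(\mathbf x_p+r\underline\omega)=0$ there. Let $f_0:\mathbb R^{p+1}\to\mathbb A$ be a polynomial in $x_0,\dots,x_p$ with coefficients in $\mathbb A$. Then the series in $$CK[f_0](\mathbf x_p+r\underline\omega)=\sum_{k=0}^{\infty}\frac{r^{2k}}{(2k)!}(-\Delta_{\mathbf x_p})^kf_0(\mathbf x_p)+\underline\omega\sum_{k=0}^{\infty}\frac{r^{2k+1}}{(2k+1)!}(-\Delta_{\mathbf x_p})^k\big(D_{\mathbf x_p}f_0(\mathbf x_p)\big),\qquad \mathbf x_p\in\mathbb R^{p+1},\ r\ge0,\ \underline\omega\in\mathbb S,$$ converge everywhere, and $CK[f_0]$ is the unique function on all of $M$ that is generalized partial-slice monogenic of type $(p,q)$ and coincides with $f_0$ on $\mathbb R^{p+1}$. -/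

import Mathlib

open scoped Nat

/-- A unital, possibly non-associative ring whose additive group carries a norm. No compatibility
between the norm and the product is required; on a finite-dimensional real vector space every norm
induces the natural topology and differential structure. -/
class NormedNonAssocRing (A : Type*) extends NormedAddCommGroup A, NonAssocRing A

/-- Alternative ring: the associator vanishes as soon as two of its arguments coincide. -/
class IsAlternativeRing (A : Type*) [NonAssocRing A] : Prop where
  left_alternative : ∀ a b : A, associator a a b = 0
  right_alternative : ∀ a b : A, associator a b b = 0
  flexible : ∀ a b : A, associator a b a = 0

namespace PartialSlice

noncomputable section

section Algebra

variable (A : Type*) [NormedNonAssocRing A] [NormedSpace ℝ A] [StarRing A]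

/-- The sphere `𝕊_A` of imaginary units: `t(x) = x + xᶜ = 0` and `n(x) = x xᶜ = 1`. -/
def imaginaryUnits : Set A := {x | x + star x = 0 ∧ x * star x = 1}

/-- The quadratic cone `Q_A`. -/
def quadraticCone : Set A :=
  {x | ∃ a : ℝ, x = a • (1 : A)} ∪
  {x | ∃ t n : ℝ, x + star x = t • (1 : A) ∧ x * star x = n • (1 : A) ∧ t ^ 2 < 4 * n}

variable {A}

/-- `M` is a hypercomplex subspace of `A`: `ℝ ⊊ M ⊆ Q_A`. -/
def IsHypercomplexSubspace (M : Submodule ℝ A) : Prop :=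
  Submodule.span ℝ {(1 : A)} < M ∧ (M : Set A) ⊆ quadraticCone A

/-- `(v₀, …, v_m)` is a hypercomplex basis of `M`. -/
structure IsHypercomplexBasis {M : Submodule ℝ A} {m : ℕ}
    (v : Module.Basis (Fin (m + 1)) ℝ M) : Prop where
  one_le : 1 ≤ m
  zero_eq : (v 0 : A) = 1
  mem_imaginaryUnits : ∀ s, s ≠ 0 → (v s : A) ∈ imaginaryUnits A
  anticomm : ∀ s t, s ≠ 0 → t ≠ 0 → s ≠ t → (v s : A) * (v t : A) = -((v t : A) * (v s : A))

end Algebra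

variable {A : Type*} [NormedNonAssocRing A] [NormedSpace ℝ A]
  {M : Submodule ℝ A} {m p : ℕ} (hp : p < m) (v : Module.Basis (Fin (m + 1)) ℝ M)

/-- The index `s ∈ {0, …, p}` seen in `{0, …, m}`. -/
def idx (i : Fin (p + 1)) : Fin (m + 1) := Fin.castLE (Nat.succ_le_succ hp.le) i

/-- The inclusion `ℝ^{p+1} → M`, `(x₀, …, x_p) ↦ ∑_{s ≤ p} x_s v_s`. -/
def inclusion (y : Fin (p + 1) → ℝ) : M := ∑ i, y i • v (idx hp i)

/-- The `ℝ^{p+1}`-part `(x₀, …, x_p)` of `x ∈ M`. -/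
def headPart (x : M) : Fin (p + 1) → ℝ := fun i => v.repr x (idx hp i)

/-- The `ℝ^q`-part `∑_{s > p} x_s v_s` of `x ∈ M`. -/
def tailPart (p : ℕ) (x : M) : M :=
  ∑ s ∈ Finset.univ.filter (fun s : Fin (m + 1) => p < (s : ℕ)), v.repr x s • v s

/-- The Euclidean length `r = (∑_{s > p} x_s²)^{1/2}` of the `ℝ^q`-part of `x ∈ M`. -/
def tailRadius (p : ℕ) (x : M) : ℝ :=
  Real.sqrt (∑ s ∈ Finset.univ.filter (fun s : Fin (m + 1) => p < (s : ℕ)), (v.repr x s) ^ 2)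

/-- The unit sphere `𝕊` of `ℝ^q`, as a subset of `M`. -/
def unitSphere (p : ℕ) : Set M :=
  {x | (∀ s : Fin (m + 1), (s : ℕ) ≤ p → v.repr x s = 0) ∧
    ∑ s ∈ Finset.univ.filter (fun s : Fin (m + 1) => p < (s : ℕ)), (v.repr x s) ^ 2 = 1}

/-- The point `x_p + r ω` of the slice `ℝ^{p+1} ⊕ ω ℝ`. -/
def slicePoint (ω : M) (z : (Fin (p + 1) → ℝ) × ℝ) : M := inclusion hp v z.1 + z.2 • ω

/-- The operator `D_{x_p} g = ∑_{s ≤ p} v_s ∂_{x_s} g`. -/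
def diracHead (g : (Fin (p + 1) → ℝ) → A) (y : Fin (p + 1) → ℝ) : A :=
  ∑ i, (v (idx hp i) : A) * lineDeriv ℝ g y (Pi.single i 1)

/-- The operator `-Δ_{x_p}`, where `Δ_{x_p} g = ∑_{s ≤ p} ∂_{x_s} (∂_{x_s} g)`. -/
def negLaplacian (g : (Fin (p + 1) → ℝ) → A) (y : Fin (p + 1) → ℝ) : A :=
  -∑ i, lineDeriv ℝ (fun z => lineDeriv ℝ g z (Pi.single i 1)) y (Pi.single i 1)

/-- The operator `D_ω F = (D_{x_p} + ω ∂_r) F` on functions of `(x_p, r) ∈ ℝ^{p+2}`. -/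
def diracSlice (ω : M) (F : (Fin (p + 1) → ℝ) × ℝ → A) (z : (Fin (p + 1) → ℝ) × ℝ) : A :=
  diracHead hp v (fun y => F (y, z.2)) z.1 + (ω : A) * deriv (fun r => F (z.1, r)) z.2

/-- `f` is left generalized partial-slice monogenic of type `(p, m - p)` on the open set `Ω ⊆ M`
(only the values of `f` on `Ω` matter). -/
def IsGSM (Ω : TopologicalSpace.Opens M) (f : M → A) : Prop :=
  ∀ ω ∈ unitSphere v p,
    ContDiffOn ℝ 1 (fun z => f (slicePoint hp v ω z)) {z | slicePoint hp v ω z ∈ Ω} ∧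
    ∀ z, slicePoint hp v ω z ∈ Ω → diracSlice hp v ω (fun w => f (slicePoint hp v ω w)) z = 0

/-- `f₀ : ℝ^{p+1} → A` is a polynomial in `x₀, …, x_p` with coefficients in `A`. -/
def IsPolynomialFun (f₀ : (Fin (p + 1) → ℝ) → A) : Prop :=
  ∃ c : (Fin (p + 1) →₀ ℕ) →₀ A, ∀ y, f₀ y = c.sum fun k a => (∏ i, y i ^ k i) • a

/-- The terms `r^{2k}/(2k)! (-Δ_{x_p})^k f₀(x_p)`. -/
def ckEvenTerm (f₀ : (Fin (p + 1) → ℝ) → A) (y : Fin (p + 1) → ℝ) (r : ℝ) (k : ℕ) : A :=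
  (r ^ (2 * k) / ((2 * k)! : ℝ)) • (negLaplacian^[k] f₀) y

/-- The terms `r^{2k+1}/(2k+1)! (-Δ_{x_p})^k (D_{x_p} f₀)(x_p)`. -/
def ckOddTerm (f₀ : (Fin (p + 1) → ℝ) → A) (y : Fin (p + 1) → ℝ) (r : ℝ) (k : ℕ) : A :=
  (r ^ (2 * k + 1) / ((2 * k + 1)! : ℝ)) • (negLaplacian^[k] (diracHead hp v f₀)) y

/-- The value of the Cauchy-Kovalevskaya series at `x_p + r ω`. -/
def ckSeries (f₀ : (Fin (p + 1) → ℝ) → A) (y : Fin (p + 1) → ℝ) (r : ℝ) (ω : M) : A :=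
  ∑' k, ckEvenTerm f₀ y r k + (ω : A) * ∑' k, ckOddTerm hp v f₀ y r k

/-- The function `CK[f₀]` on `M`: the value at `x = x_p + r ω` is that of the series, where
`r = |x_q|` and `ω = x_q / |x_q|`. When `r = 0` the choice of `ω` is irrelevant, see
`CK_slicePoint`. -/
def CK (f₀ : (Fin (p + 1) → ℝ) → A) (x : M) : A :=
  ckSeries hp v f₀ (headPart hp v x) (tailRadius v p x) ((tailRadius v p x)⁻¹ • tailPart v p x)

lemma idx_val (i : Fin (p + 1)) : (idx hp i : ℕ) = i := rfl

lemma repr_inclusion_head (y : Fin (p + 1) → ℝ) (i : Fin (p + 1)) :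
    v.repr (inclusion hp v y) (idx hp i) = y i := by
  have h : ∀ j, (idx hp j = idx hp i) = (j = i) := fun j => by
    simp [Fin.ext_iff, idx_val]
  simp [inclusion, Finsupp.single_apply, h]

lemma repr_inclusion_tail (y : Fin (p + 1) → ℝ) (s : Fin (m + 1)) (hs : p < (s : ℕ)) :
    v.repr (inclusion hp v y) s = 0 := by
  simp only [inclusion, map_sum, map_smul, Module.Basis.repr_self, Finsupp.coe_finsetSum,
    Finset.sum_apply, Finsupp.smul_apply]
  refine Finset.sum_eq_zero fun j _ => ?_
  have : idx hp j ≠ s := fun h => by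
    have := congrArg Fin.val h
    rw [idx_val] at this
    omega
  simp [this]

/-- At `x_p + r ω` with `r ≥ 0` and `ω ∈ 𝕊`, the function `CK[f₀]` is given by the series. -/
lemma CK_slicePoint (f₀ : (Fin (p + 1) → ℝ) → A) (y : Fin (p + 1) → ℝ) {r : ℝ} (hr : 0 ≤ r)
    {ω : M} (hω : ω ∈ unitSphere v p) :
    CK hp v f₀ (slicePoint hp v ω (y, r)) = ckSeries hp v f₀ y r ω := by
  obtain ⟨h0, h1⟩ := hω
  have hy : headPart hp v (slicePoint hp v ω (y, r)) = y := by
    funext i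
    have := h0 (idx hp i) (by rw [idx_val]; omega)
    simp [headPart, slicePoint, repr_inclusion_head, this]
  have ht : ∀ s : Fin (m + 1), p < (s : ℕ) →
      v.repr (slicePoint hp v ω (y, r)) s = r * v.repr ω s := fun s hs => by
    simp [slicePoint, repr_inclusion_tail hp v y s hs]
  have hR : tailRadius v p (slicePoint hp v ω (y, r)) = r := by
    unfold tailRadius
    rw [Finset.sum_congr rfl (g := fun s => r ^ 2 * (v.repr ω s) ^ 2), ← Finset.mul_sum, h1,
      mul_one, Real.sqrt_sq hr]
    intro s hs
    rw [ht s (Finset.mem_filter.1 hs).2]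
    ring
  have hω' : ∑ s ∈ Finset.univ.filter (fun s : Fin (m + 1) => p < (s : ℕ)),
      v.repr ω s • v s = ω := by
    conv_rhs => rw [← v.sum_repr ω]
    refine Finset.sum_subset (Finset.subset_univ _) fun s _ hs => ?_
    rw [h0 s (by simpa using hs), zero_smul]
  have hT : tailPart v p (slicePoint hp v ω (y, r)) = r • ω := by
    unfold tailPart
    conv_rhs => rw [← hω', Finset.smul_sum]
    refine Finset.sum_congr rfl fun s hs => ?_
    rw [ht s (Finset.mem_filter.1 hs).2, mul_smul]
  rw [CK, hy, hR, hT]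
  rcases hr.eq_or_lt with rfl | hr
  · simp [ckSeries, ckOddTerm]
  · rw [inv_smul_smul₀ hr.ne']

end

end PartialSlice

/-! Existence. High powers of the Laplacian kill a polynomial, so both series are finite sums,
smooth in `(x_p, r)`. Alternativity and the anticommutation of the basis give `ω (ω x) = -x` and `D
(ω D g) = ω Δ g`. With these, `D` of the even terms cancels `ω ∂_r` of the odd terms, and `D` of the
odd terms cancels `ω ∂_r` of the even terms (`diracSlice_ckSeries`). The series is invariant under
`(r, ω) ↦ (-r, -ω)`, so the formula stays valid on the whole slice, including `r < 0`.

Uniqueness. Every point of `M` lies on a slice, so it suffices to compare two solutions on one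
slice. Their difference `H` is only `C^1`, solves a first-order system `∑ E_a ∂_a H = 0` that
factors the Laplacian, and vanishes on `r = 0`. The equation then forces the full derivative of `H`
to vanish on `r = 0`, so extension by zero to `r < 0` is again a `C^1` solution
(`eq_zero_of_cauchy_data`). It is weakly harmonic and vanishes on an open set.

Unique continuation (`eq_zero_of_weakly_harmonic`) is obtained without regularity theory: testing
against `Q(x) g(|x|^2)`, with `Q` a homogeneous polynomial and `g` solving a radial ODE, shows that
`u χ(|x|^2)` is orthogonal to all polynomials for every cut-off `χ`. Stone–Weierstrass then gives `u
= 0`. -/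

namespace PartialSlice

/-! ### Unique continuation for weakly harmonic functions. -/

open MeasureTheory Filter Topology Set

/-- Solution of the singular linear equation `4 s g'' + 4 a g' = χ` on `[δ, ∞)` which vanishes for
large arguments. -/
lemma exists_radial_profile (a : ℝ) {δ R : ℝ} (hδ : 0 < δ) {χ : ℝ → ℝ} (hχ : Continuous χ)
    (hR : ∀ s, R ≤ s → χ s = 0) :
    ∃ g : ℝ → ℝ, ContDiff ℝ 2 g ∧ (∀ s, R ≤ s → g s = 0) ∧
      ∀ s, δ ≤ s → 4 * s * deriv (deriv g) s + 4 * a * deriv g s = χ s := by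
  -- Replacing `s` by `max s δ` removes the singularity at `0` and changes nothing on `[δ, ∞)`. The
  -- equation is first order in `k = g'`, with integrating factor `exp l`. Integrating from `R`
  -- makes `k` and `g` vanish beyond `R`.
  have hm : ∀ s, 0 < max s δ := fun s => lt_max_of_lt_right hδ
  have hmc : Continuous fun s => max s δ := by fun_prop
  have hac : Continuous fun s => a / max s δ :=
    continuous_const.div hmc fun s => (hm s).ne'
  set l : ℝ → ℝ := fun s => ∫ t in (0 : ℝ)..s, a / max t δ with hl
  have hl' : ∀ s, HasDerivAt l (a / max s δ) s := fun s =>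
    (hac.integral_hasStrictDerivAt 0 s).hasDerivAt
  have hlc : Continuous l := continuous_iff_continuousAt.2 fun s => (hl' s).continuousAt
  have hkc : Continuous fun t => Real.exp (l t) * χ t / (4 * max t δ) :=
    ((Real.continuous_exp.comp hlc).mul hχ).div (continuous_const.mul hmc)
      fun s => (mul_pos four_pos (hm s)).ne'
  set h : ℝ → ℝ := fun s => ∫ t in R..s, Real.exp (l t) * χ t / (4 * max t δ) with hh
  have hh' : ∀ s, HasDerivAt h (Real.exp (l s) * χ s / (4 * max s δ)) s := fun s =>
    (hkc.integral_hasStrictDerivAt R s).hasDerivAt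
  have hhc : Continuous h := continuous_iff_continuousAt.2 fun s => (hh' s).continuousAt
  have hh0 : ∀ s, R ≤ s → h s = 0 := fun s hs => by
    refine (intervalIntegral.integral_congr (g := fun _ => (0 : ℝ)) fun t ht => ?_).trans (by simp)
    rw [uIcc_of_le hs] at ht
    simp [hR t ht.1]
  set k : ℝ → ℝ := fun s => Real.exp (-l s) * h s with hk
  have hk' : ∀ s, HasDerivAt k (-(a / max s δ) * k s + χ s / (4 * max s δ)) s := fun s => by
    refine (((hl' s).fun_neg.exp).fun_mul (hh' s)).congr_deriv ?_
    have : Real.exp (-l s) * Real.exp (l s) = 1 := by rw [← Real.exp_add]; simp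
    simp only [hk]
    linear_combination (χ s / (4 * max s δ)) * this
  have hkc : Continuous k := continuous_iff_continuousAt.2 fun s => (hk' s).continuousAt
  have hkd : deriv k = fun s => -(a / max s δ) * k s + χ s / (4 * max s δ) :=
    funext fun s => (hk' s).deriv
  have hg' : ∀ s, HasDerivAt (fun s => ∫ t in R..s, k t) (k s) s := fun s =>
    (hkc.integral_hasStrictDerivAt R s).hasDerivAt
  have hgd : deriv (fun s => ∫ t in R..s, k t) = k := funext fun s => (hg' s).deriv
  refine ⟨fun s => ∫ t in R..s, k t, ?_, fun s hs => ?_, fun s hs => ?_⟩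
  · rw [show (2 : WithTop ℕ∞) = 1 + 1 by norm_num, contDiff_succ_iff_deriv]
    refine ⟨fun s => (hg' s).differentiableAt, by simp, ?_⟩
    rw [hgd, contDiff_one_iff_deriv]
    refine ⟨fun s => (hk' s).differentiableAt, ?_⟩
    rw [hkd]
    exact (hac.neg.mul hkc).add
      (hχ.div (continuous_const.mul hmc) fun s => (mul_pos four_pos (hm s)).ne')
  · refine (intervalIntegral.integral_congr (g := fun _ => (0 : ℝ)) fun t ht => ?_).trans (by simp)
    rw [uIcc_of_le hs] at ht
    simp [hk, hh0 t ht.1]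
  · rw [hgd, hkd]
    have : 0 < s := hδ.trans_le hs
    simp only [max_eq_left hs]
    field_simp
    ring

variable {ι : Type*} [Fintype ι] [DecidableEq ι]

lemma hasLineDerivAt_eval (Q : MvPolynomial ι ℝ) (x : ι → ℝ) (i : ι) :
    HasLineDerivAt ℝ (fun x => MvPolynomial.eval x Q) (MvPolynomial.eval x (Q.pderiv i)) x
      (Pi.single i 1) := by
  have hX : ∀ j, HasLineDerivAt ℝ (fun x : ι → ℝ => x j) ((Pi.single i 1 : ι → ℝ) j) x
      (Pi.single i 1) := fun j =>
    ((ContinuousLinearMap.proj j : (ι → ℝ) →L[ℝ] ℝ).hasFDerivAt (x := x)).hasLineDerivAt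
      (Pi.single i 1)
  induction Q using MvPolynomial.induction_on with
  | C a => simpa [HasLineDerivAt] using hasDerivAt_const (0 : ℝ) a
  | add P Q hP hQ => simpa [HasLineDerivAt] using HasDerivAt.fun_add hP hQ
  | mul_X P j hP =>
    have := HasDerivAt.fun_mul hP (hX j)
    simp only [HasLineDerivAt, Derivation.leibniz, MvPolynomial.pderiv_X, map_mul, map_add,
      MvPolynomial.eval_X, smul_eq_mul] at this ⊢
    refine this.congr_deriv ?_
    rcases eq_or_ne j i with rfl | h
    · simp; ring
    · simp [h, mul_comm]

omit [DecidableEq ι] in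
lemma contDiff_eval {n : WithTop ℕ∞} (Q : MvPolynomial ι ℝ) :
    ContDiff ℝ n fun x : ι → ℝ => MvPolynomial.eval x Q := by
  induction Q using MvPolynomial.induction_on with
  | C a => simpa using contDiff_const
  | add P Q hP hQ => simpa using hP.add hQ
  | mul_X P j hP => simpa using hP.mul (contDiff_apply ℝ ℝ j)

omit [DecidableEq ι] in
lemma contDiff_sum_sq {n : WithTop ℕ∞} : ContDiff ℝ n fun x : ι → ℝ => ∑ i, x i ^ 2 :=
  ContDiff.sum fun i _ => (contDiff_apply ℝ ℝ i).pow 2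

omit [DecidableEq ι] in
lemma norm_sq_le_sum_sq (x : ι → ℝ) : ‖x‖ ^ 2 ≤ ∑ i, x i ^ 2 := by
  have : ‖x‖ ≤ Real.sqrt (∑ i, x i ^ 2) :=
    (pi_norm_le_iff_of_nonneg (Real.sqrt_nonneg _)).2 fun i => Real.abs_le_sqrt
      (Finset.single_le_sum (f := fun i => x i ^ 2) (fun _ _ => sq_nonneg _) (Finset.mem_univ i))
  exact (Real.le_sqrt (norm_nonneg _) (by positivity)).1 this

lemma hasLineDerivAt_sum_sq (x : ι → ℝ) (i : ι) :
    HasLineDerivAt ℝ (fun x : ι → ℝ => ∑ j, x j ^ 2) (2 * x i) x (Pi.single i 1) := by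
  have := hasLineDerivAt_eval (∑ j, MvPolynomial.X j ^ 2 : MvPolynomial ι ℝ) x i
  convert this using 1
  · simp
  · simp [Pi.single_apply]

/-- Leibniz' rule, with the cross term `∑ x_i ∂_i Q` evaluated by Euler's identity. The factor
multiplying `Q` is the left side of the ODE in `exists_radial_profile` with `a = n/2 + k`. -/
lemma sum_lineDeriv_lineDeriv_eval_mul {g : ℝ → ℝ} (hg : ContDiff ℝ 2 g) {k : ℕ}
    {Q : MvPolynomial ι ℝ} (hQ : Q.IsHomogeneous k) (x : ι → ℝ) :
    ∑ i, lineDeriv ℝ (fun z => lineDeriv ℝ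
        (fun y : ι → ℝ => MvPolynomial.eval y Q * g (∑ j, y j ^ 2)) z (Pi.single i 1)) x
        (Pi.single i 1) =
      MvPolynomial.eval x (∑ i, (Q.pderiv i).pderiv i) * g (∑ j, x j ^ 2) +
        MvPolynomial.eval x Q * (4 * (∑ j, x j ^ 2) * deriv (deriv g) (∑ j, x j ^ 2) +
          4 * (Fintype.card ι / 2 + k) * deriv g (∑ j, x j ^ 2)) := by
  have hg1 : ContDiff ℝ 1 (deriv g) := by
    rw [show (2 : WithTop ℕ∞) = 1 + 1 by norm_num, contDiff_succ_iff_deriv] at hg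
    exact hg.2.2
  have hc : ∀ {f : ℝ → ℝ}, ContDiff ℝ 1 f → ∀ (z : ι → ℝ) (i : ι),
      HasLineDerivAt ℝ (fun y : ι → ℝ => f (∑ j, y j ^ 2))
        (deriv f (∑ j, z j ^ 2) * (2 * z i)) z (Pi.single i 1) := fun {f} hf z i => by
    have h1 : HasDerivAt f (deriv f (∑ j, z j ^ 2))
        (∑ j, (z + (0 : ℝ) • (Pi.single i 1 : ι → ℝ)) j ^ 2) := by
      simpa using ((hf.differentiable one_ne_zero) (∑ j, z j ^ 2)).hasDerivAt
    exact HasDerivAt.comp (0 : ℝ) h1 (hasLineDerivAt_sum_sq z i)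
  have hw : ∀ (z : ι → ℝ) (i : ι), lineDeriv ℝ
      (fun y : ι → ℝ => MvPolynomial.eval y Q * g (∑ j, y j ^ 2)) z (Pi.single i 1) =
      MvPolynomial.eval z (Q.pderiv i) * g (∑ j, z j ^ 2) +
        MvPolynomial.eval z (Q * (2 * MvPolynomial.X i)) * deriv g (∑ j, z j ^ 2) := fun z i => by
    refine HasLineDerivAt.lineDeriv ?_
    refine (HasDerivAt.fun_mul (hasLineDerivAt_eval Q z i)
      (hc (hg.of_le one_le_two) z i)).congr_deriv ?_
    simp [mul_assoc, mul_comm, mul_left_comm]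
  have hww : ∀ i : ι, lineDeriv ℝ (fun z => lineDeriv ℝ
        (fun y : ι → ℝ => MvPolynomial.eval y Q * g (∑ j, y j ^ 2)) z (Pi.single i 1)) x
        (Pi.single i 1) =
      MvPolynomial.eval x ((Q.pderiv i).pderiv i) * g (∑ j, x j ^ 2) +
        4 * MvPolynomial.eval x (MvPolynomial.X i * Q.pderiv i) * deriv g (∑ j, x j ^ 2) +
        MvPolynomial.eval x Q * (4 * x i ^ 2 * deriv (deriv g) (∑ j, x j ^ 2) +
          2 * deriv g (∑ j, x j ^ 2)) := fun i => by
    simp only [hw]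
    refine HasLineDerivAt.lineDeriv ?_
    refine ((HasDerivAt.fun_mul (hasLineDerivAt_eval (Q.pderiv i) x i)
      (hc (hg.of_le one_le_two) x i)).fun_add (HasDerivAt.fun_mul
      (hasLineDerivAt_eval (Q * (2 * MvPolynomial.X i)) x i) (hc hg1 x i))).congr_deriv ?_
    have h2 : (MvPolynomial.pderiv i) (2 : MvPolynomial ι ℝ) = 0 :=
      (MvPolynomial.pderiv i).map_natCast 2
    simp [Derivation.leibniz, h2]
    ring
  have he := congrArg (MvPolynomial.eval x) hQ.sum_X_mul_pderiv
  simp only [map_sum, nsmul_eq_mul, map_mul, map_natCast] at he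
  simp only [hww, Finset.sum_add_distrib, ← Finset.mul_sum, ← Finset.sum_mul, map_sum, map_mul, he]
  simp
  ring

/-- Unique continuation for continuous weakly harmonic functions which vanish near the origin. -/
theorem eq_zero_of_weakly_harmonic {u : (ι → ℝ) → ℝ} (hu : Continuous u)
    (hw : ∀ w : (ι → ℝ) → ℝ, ContDiff ℝ 2 w → HasCompactSupport w →
      ∫ x, (∑ i, lineDeriv ℝ (fun z => lineDeriv ℝ w z (Pi.single i 1)) x (Pi.single i 1)) * u x
        = 0)
    {δ : ℝ} (hδ : 0 < δ) (h0 : ∀ x, ∑ i, x i ^ 2 ≤ δ → u x = 0) : u = 0 := by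
  have hs : Continuous fun x : ι → ℝ => ∑ i, x i ^ 2 := (contDiff_sum_sq (n := 0)).continuous
  have hsupp : ∀ {χ : ℝ → ℝ} {R : ℝ}, (∀ s, R ≤ s → χ s = 0) → ∀ f : (ι → ℝ) → ℝ,
      HasCompactSupport fun x => f x * χ (∑ i, x i ^ 2) := fun {χ R} hR f => by
    refine HasCompactSupport.intro (isCompact_closedBall (0 : ι → ℝ) (|R| + 1)) fun x hx => ?_
    rw [mem_closedBall_zero_iff, not_le] at hx
    rw [hR, mul_zero]
    have := norm_sq_le_sum_sq x
    nlinarith [le_abs_self R, abs_nonneg R]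
  -- Strong induction on the degree. With `g` the radial profile of `χ`, the test function `Q
  -- g(|x|^2)` produces `Q χ` plus `ΔQ g`, and `ΔQ` has degree `k - 2`. The cut-off must be
  -- arbitrary because `g` takes the place of `χ` in the induction hypothesis.
  have key : ∀ (k : ℕ) (Q : MvPolynomial ι ℝ), Q.IsHomogeneous k → ∀ (χ : ℝ → ℝ) (R : ℝ),
      Continuous χ → (∀ s, R ≤ s → χ s = 0) →
      ∫ x, MvPolynomial.eval x Q * χ (∑ i, x i ^ 2) * u x = 0 := by
    intro k
    induction k using Nat.strong_induction_on with
    | _ k ih =>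
    intro Q hQ χ R hχ hR
    obtain ⟨g, hg, hgR, hode⟩ :=
      exists_radial_profile (Fintype.card ι / 2 + k) hδ hχ hR
    have hlap : ∫ x, MvPolynomial.eval x (∑ i, (Q.pderiv i).pderiv i) * g (∑ i, x i ^ 2) * u x
        = 0 := by
      rcases lt_or_ge k 2 with hk | hk
      · have : ∀ i, (Q.pderiv i).pderiv i = 0 := fun i => by
          have h := (hQ.pderiv (i := i))
          rw [show k - 1 = 0 by omega, ← MvPolynomial.totalDegree_zero_iff_isHomogeneous,
            MvPolynomial.totalDegree_eq_zero_iff_eq_C] at h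
          rw [h, MvPolynomial.pderiv_C]
        simp [this]
      · exact ih (k - 1 - 1) (by omega) _
          (MvPolynomial.IsHomogeneous.sum _ _ _ fun i _ => hQ.pderiv.pderiv) g R
          hg.continuous hgR
    have h := hw _ ((contDiff_eval Q).mul (hg.comp contDiff_sum_sq)) (hsupp hgR _)
    have hint : ∀ (P : MvPolynomial ι ℝ) {χ : ℝ → ℝ}, Continuous χ → (∀ s, R ≤ s → χ s = 0) →
        Integrable fun x => MvPolynomial.eval x P * χ (∑ i, x i ^ 2) * u x := fun P χ hχ hR =>
      ((((contDiff_eval (n := 0) P).continuous.mul (hχ.comp hs))).mul hu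
        ).integrable_of_hasCompactSupport ((hsupp hR _).mul_right)
    rw [integral_congr_ae (Eventually.of_forall fun x => show _ =
      MvPolynomial.eval x (∑ i, (Q.pderiv i).pderiv i) * g (∑ i, x i ^ 2) * u x +
      MvPolynomial.eval x Q * χ (∑ i, x i ^ 2) * u x from ?_),
      integral_add (hint _ hg.continuous hgR) (hint _ hχ hR), hlap, zero_add] at h
    · exact h
    -- The ODE holds only for `|x|^2 ≥ δ`; on the remaining ball `u` is zero.
    · rcases le_total (∑ i, x i ^ 2) δ with hx | hx
      · simp [h0 x hx]
      · rw [← add_mul, ← hode _ hx, ← sum_lineDeriv_lineDeriv_eval_mul hg hQ x]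
        rfl
  have key' : ∀ (Q : MvPolynomial ι ℝ) (χ : ℝ → ℝ) (R : ℝ),
      Continuous χ → (∀ s, R ≤ s → χ s = 0) →
      ∫ x, MvPolynomial.eval x Q * (χ (∑ i, x i ^ 2) * u x) = 0 := by
    intro Q χ R hχ hR
    rw [← Q.sum_homogeneousComponent]
    simp only [map_sum, Finset.sum_mul]
    rw [integral_finsetSum]
    · exact Finset.sum_eq_zero fun k _ => by
        simpa [mul_assoc] using
          key k _ (MvPolynomial.homogeneousComponent_isHomogeneous k Q) χ R hχ hR
    · intro k _
      simp only [← mul_assoc]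
      exact ((((contDiff_eval (n := 0) _).continuous.mul (hχ.comp hs))).mul hu
        ).integrable_of_hasCompactSupport ((hsupp hR _).mul_right)
  funext z
  -- This cut-off takes the value `1` at `|z|^2`, so `f z = u z`.
  set R : ℝ := ∑ i, z i ^ 2 + 1 with hRdef
  set χ : ℝ → ℝ := fun s => max (R - s) 0 with hχdef
  have hχ : Continuous χ := by fun_prop
  have hR : ∀ s, R ≤ s → χ s = 0 := fun s hs => max_eq_right (by linarith)
  set f : (ι → ℝ) → ℝ := fun x => χ (∑ i, x i ^ 2) * u x with hf
  have hfc : Continuous f := (hχ.comp hs).mul hu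
  have hfs : HasCompactSupport f := by
    rw [show f = fun x => u x * χ (∑ i, x i ^ 2) from funext fun x => mul_comm _ _]
    exact hsupp hR u
  have hfi : Integrable fun x => ‖f x‖ := hfc.norm.integrable_of_hasCompactSupport hfs.norm
  let S : Subalgebra ℝ C(ι → ℝ, ℝ) :=
    (MvPolynomial.aeval fun i => (⟨fun x => x i, continuous_apply i⟩ : C(ι → ℝ, ℝ))).range
  have hSe : ∀ (Q : MvPolynomial ι ℝ) (x : ι → ℝ),
      (MvPolynomial.aeval fun i => (⟨fun x => x i, continuous_apply i⟩ : C(ι → ℝ, ℝ))) Q x =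
        MvPolynomial.eval x Q := fun Q x => by
    induction Q using MvPolynomial.induction_on with
    | C a => simp
    | add P Q hP hQ => simp [hP, hQ]
    | mul_X P j hP => simp [hP]
  have hS : S.SeparatesPoints := fun x y hxy => by
    obtain ⟨i, hi⟩ := Function.ne_iff.1 hxy
    exact ⟨_, ⟨_, ⟨MvPolynomial.X i, rfl⟩, rfl⟩, by simpa using hi⟩
  -- Approximate `f` within `ε` on its support by a polynomial `Q`. Since `∫ Q f = 0`, one has `∫
  -- f^2 = ∫ (f - Q) f ≤ ε ∫ |f|`.
  have hle : ∀ ε > 0, ∫ x, f x * f x ≤ ε * ∫ x, ‖f x‖ := fun ε hε => by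
    obtain ⟨_, ⟨Q, rfl⟩, hQ⟩ :=
      ContinuousMap.exists_mem_subalgebra_near_continuous_of_isCompact_of_separatesPoints hS
        ⟨f, hfc⟩ hfs hε
    have h1 := key' Q χ R hχ hR
    have h2 : ∫ x, f x * f x = ∫ x, (f x - MvPolynomial.eval x Q) * f x := by
      simp only [sub_mul]
      rw [integral_sub, h1, sub_zero]
      · exact (hfc.mul hfc).integrable_of_hasCompactSupport hfs.mul_right
      · exact ((contDiff_eval (n := 0) Q).continuous.mul hfc).integrable_of_hasCompactSupport
          hfs.mul_left
    rw [h2, ← integral_const_mul]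
    refine integral_mono (((hfc.sub (contDiff_eval (n := 0) Q).continuous).mul
      hfc).integrable_of_hasCompactSupport hfs.mul_left) (hfi.const_mul _) fun x => ?_
    by_cases hx : x ∈ tsupport f
    · have := hQ x hx
      simp only [AlgHom.toRingHom_eq_coe, RingHom.coe_coe, hSe, ContinuousMap.coe_mk] at this
      refine (le_abs_self _).trans ?_
      rw [abs_mul]
      refine mul_le_mul_of_nonneg_right ?_ (abs_nonneg _)
      rw [abs_sub_comm]
      exact this.le
    · simp [image_eq_zero_of_notMem_tsupport hx]
  have hff : ∫ x, f x * f x ≤ 0 := by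
    refine ge_of_tendsto (f := fun ε : ℝ => ε * ∫ x, ‖f x‖) (x := 𝓝[>] 0) ?_ ?_
    · have : Tendsto (fun ε : ℝ => ε * ∫ x, ‖f x‖) (𝓝 0) (𝓝 (0 * ∫ x, ‖f x‖)) :=
        tendsto_id.mul_const _
      rw [zero_mul] at this
      exact this.mono_left nhdsWithin_le_nhds
    · filter_upwards [self_mem_nhdsWithin] with ε hε using hle ε hε
  have hf0 : f z = 0 := by
    by_contra hz
    refine hff.not_gt ((hfc.mul hfc).integral_pos_of_hasCompactSupport_nonneg_nonzero
      hfs.mul_right (fun x => mul_self_nonneg _) (x := z) (mul_ne_zero hz hz))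
  have hχz : χ (∑ i, z i ^ 2) = 1 := by simp [hχdef, hRdef]
  simpa [hf, hχz] using hf0

end PartialSlice

/-! ### First-order systems factoring the Laplacian, and Cauchy data on a hyperplane. -/

namespace PartialSlice

open MeasureTheory Filter Topology Set

variable {ι : Type*} [Fintype ι] [DecidableEq ι] {V : Type*} [NormedAddCommGroup V]
  [NormedSpace ℝ V]

/-- Two families of constant coefficients `E`, `E'` such that the composition of the first order
operators `∑ E'_b ∂_b` and `∑ E_a ∂_a` is the Laplacian. -/
def FactorsLaplacian (E E' : ι → V →L[ℝ] V) : Prop :=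
  ∀ a b x, E' b (E a x) + E' a (E b x) = if a = b then (2 : ℝ) • x else 0

omit [DecidableEq ι] in
lemma lineDeriv_lineDeriv_comm {w : (ι → ℝ) → V} (hw : ContDiff ℝ 2 w) (x a b : ι → ℝ) :
    lineDeriv ℝ (fun z => lineDeriv ℝ w z a) x b = lineDeriv ℝ (fun z => lineDeriv ℝ w z b) x a := by
  have hd : Differentiable ℝ w := hw.differentiable two_ne_zero
  have hd' : Differentiable ℝ (fderiv ℝ w) :=
    (hw.fderiv_right (m := 1) (by norm_num)).differentiable one_ne_zero
  have h : ∀ c d : ι → ℝ, lineDeriv ℝ (fun z => lineDeriv ℝ w z c) x d =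
      fderiv ℝ (fderiv ℝ w) x d c := fun c d => by
    have : (fun z => lineDeriv ℝ w z c) = fun z => fderiv ℝ w z c :=
      funext fun z => (hd z).lineDeriv_eq_fderiv
    rw [this, (DifferentiableAt.clm_apply (hd' x) (by fun_prop)).lineDeriv_eq_fderiv,
      fderiv_clm_apply (hd' x) (by fun_prop)]
    simp
  rw [h, h]
  exact (hw.contDiffAt.isSymmSndFDerivAt (by simp)) b a

/-- As `u` is only `C^1`, second derivatives stay on `w`. Put `J a b = ∫ (∂_a ∂_b w) u`. One
integration by parts and the equation give `∑_a E_a (J a b) = 0` for each `b`. Applying `E'_b`,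
summing and symmetrizing (`J` is symmetric) yields `2 ∑ J a a = 0`. -/
lemma integrable_and_integral_laplacian_smul_eq_zero [CompleteSpace V] {E E' : ι → V →L[ℝ] V}
    (hE : FactorsLaplacian E E') {u : (ι → ℝ) → V} (hu : ContDiff ℝ 1 u)
    (hLu : ∀ x, ∑ a, E a (fderiv ℝ u x (Pi.single a 1)) = 0) {w : (ι → ℝ) → ℝ}
    (hw : ContDiff ℝ 2 w) (hws : HasCompactSupport w) :
    Integrable (fun x => (∑ i, lineDeriv ℝ (fun z => lineDeriv ℝ w z (Pi.single i 1)) x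
      (Pi.single i 1)) • u x) ∧
    ∫ x, (∑ i, lineDeriv ℝ (fun z => lineDeriv ℝ w z (Pi.single i 1)) x (Pi.single i 1)) • u x
      = 0 := by
  have hd : Differentiable ℝ w := hw.differentiable two_ne_zero
  set D : ι → (ι → ℝ) → ℝ := fun b z => lineDeriv ℝ w z (Pi.single b 1) with hD
  have hDf : ∀ b, D b = fun z => fderiv ℝ w z (Pi.single b 1) := fun b =>
    funext fun z => (hd z).lineDeriv_eq_fderiv
  have hDc : ∀ b, ContDiff ℝ 1 (D b) := fun b => by
    rw [hDf]
    exact (hw.fderiv_right (m := 1) (by norm_num)).clm_apply contDiff_const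
  have hDd : ∀ b, Differentiable ℝ (D b) := fun b => (hDc b).differentiable one_ne_zero
  have hDs : ∀ b, HasCompactSupport (D b) := fun b => by
    rw [hDf]
    exact hws.fderiv_apply ℝ _
  have hDDc : ∀ b v, Continuous fun x => fderiv ℝ (D b) x v := fun b v =>
    ((hDc b).continuous_fderiv one_ne_zero).clm_apply continuous_const
  have huc : ∀ v, Continuous fun x => fderiv ℝ u x v := fun v =>
    (hu.continuous_fderiv one_ne_zero).clm_apply continuous_const
  have hDDs : ∀ b v, HasCompactSupport fun x => fderiv ℝ (D b) x v := fun b v =>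
    (hDs b).fderiv_apply ℝ v
  have hi1 : ∀ b v, Integrable fun x => fderiv ℝ (D b) x v • u x := fun b v =>
    ((hDDc b v).smul hu.continuous).integrable_of_hasCompactSupport (hDDs b v).smul_right
  have hi2 : ∀ b v, Integrable fun x => D b x • fderiv ℝ u x v := fun b v =>
    ((hDc b).continuous.smul (huc v)).integrable_of_hasCompactSupport (hDs b).smul_right
  set J : ι → ι → V := fun a b => ∫ x, fderiv ℝ (D b) x (Pi.single a 1) • u x with hJ
  have hIBP : ∀ a b, ∫ x, D b x • fderiv ℝ u x (Pi.single a 1) = -J a b := fun a b =>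
    integral_smul_fderiv_eq_neg_fderiv_smul_of_integrable (hi1 b _) (hi2 b _)
      (((hDc b).continuous.smul hu.continuous).integrable_of_hasCompactSupport
        (hDs b).smul_right) (fun x _ => hDd b x) (fun x _ => hu.differentiable one_ne_zero x)
  have hJsymm : ∀ a b, J a b = J b a := fun a b => by
    simp only [hJ]
    congr 1
    funext x
    rw [← (hDd b x).lineDeriv_eq_fderiv, ← (hDd a x).lineDeriv_eq_fderiv]
    simp only [hD]
    rw [lineDeriv_lineDeriv_comm hw]
  have hzero : ∀ b, ∑ a, E a (J a b) = 0 := fun b => by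
    have : ∀ a, E a (J a b) = -∫ x, D b x • E a (fderiv ℝ u x (Pi.single a 1)) := fun a => by
      rw [← neg_neg (J a b), ← hIBP, map_neg, ← ContinuousLinearMap.integral_comp_comm _ (hi2 b _)]
      simp
    simp only [this]
    rw [Finset.sum_neg_distrib, ← integral_finsetSum]
    · simp [← Finset.smul_sum, hLu]
    · intro a _
      simpa using (E a).integrable_comp (hi2 b (Pi.single a 1))
  have hsum : (2 : ℝ) • ∑ a, J a a = 0 := by
    have h1 : ∑ b, ∑ a, E' b (E a (J a b)) = 0 := by
      simp only [← map_sum, hzero, map_zero, Finset.sum_const_zero]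
    have h2 : ∑ b, ∑ a, E' a (E b (J a b)) = 0 := by
      rw [Finset.sum_comm]
      simpa only [hJsymm] using h1
    calc (2 : ℝ) • ∑ a, J a a
        = ∑ b, ∑ a, (E' b (E a (J a b)) + E' a (E b (J a b))) := by
          simp [hE _ _ _, Finset.smul_sum]
      _ = 0 := by simp only [Finset.sum_add_distrib, h1, h2, add_zero]
  have h := (smul_eq_zero.1 hsum).resolve_left two_ne_zero
  have hlap : ∀ x i, lineDeriv ℝ (fun z => lineDeriv ℝ w z (Pi.single i 1)) x (Pi.single i 1) =
      fderiv ℝ (D i) x (Pi.single i 1) := fun x i => (hDd i x).lineDeriv_eq_fderiv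
  simp only [hlap, Finset.sum_smul]
  refine ⟨integrable_finsetSum _ fun a _ => hi1 a _, ?_⟩
  rw [integral_finsetSum _ fun a _ => hi1 a _]
  exact h

/-- Unique continuation for first order systems which factor the Laplacian. -/
theorem eq_zero_of_factorsLaplacian [CompleteSpace V] {E E' : ι → V →L[ℝ] V}
    (hE : FactorsLaplacian E E') {u : (ι → ℝ) → V} (hu : ContDiff ℝ 1 u)
    (hLu : ∀ x, ∑ a, E a (fderiv ℝ u x (Pi.single a 1)) = 0) {δ : ℝ} (hδ : 0 < δ)
    (h0 : ∀ x, ∑ i, x i ^ 2 ≤ δ → u x = 0) (x : ι → ℝ) : u x = 0 := by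
  refine (SeparatingDual.eq_zero_iff_forall_dual_eq_zero (R := ℝ) _).2 fun ℓ => ?_
  refine congrFun (eq_zero_of_weakly_harmonic (u := fun x => ℓ (u x)) (ℓ.continuous.comp
    hu.continuous) (fun w hw hws => ?_) hδ fun x hx => by simp [h0 x hx]) x
  obtain ⟨hi, h⟩ := integrable_and_integral_laplacian_smul_eq_zero hE hu hLu hw hws
  simpa [h] using ℓ.integral_comp_comm hi

/-- Uniqueness in the Cauchy problem with data on a hyperplane. -/
theorem eq_zero_of_cauchy_data [CompleteSpace V] {E E' : Option ι → V →L[ℝ] V}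
    (hE : FactorsLaplacian E E') {H : (ι → ℝ) × ℝ → V} (hH : ContDiff ℝ 1 H)
    (hLH : ∀ z, ∑ i, E (some i) (fderiv ℝ H z (Pi.single i 1, 0)) +
      E none (fderiv ℝ H z (0, 1)) = 0)
    (h0 : ∀ y, H (y, 0) = 0) (y : ι → ℝ) {r : ℝ} (hr : 0 ≤ r) : H (y, r) = 0 := by
  have hd := hH.differentiable one_ne_zero
  have htan : ∀ y w, fderiv ℝ H (y, 0) (w, 0) = 0 := fun y w => by
    rw [← (hd _).lineDeriv_eq_fderiv]
    simp [lineDeriv, h0]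
  -- The case `a = b = none` of `hE` makes `E' none` a left inverse of `E none`, so the equation
  -- determines the normal derivative from the tangential ones.
  have hnor : ∀ y, fderiv ℝ H (y, 0) (0, 1) = 0 := fun y => by
    have h := hLH (y, 0)
    simp only [htan, map_zero, Finset.sum_const_zero, zero_add] at h
    have h2 := hE none none (fderiv ℝ H (y, 0) (0, 1))
    rw [h] at h2
    simpa using h2.symm
  have hfd : ∀ y, fderiv ℝ H (y, 0) = 0 := fun y => by
    ext w
    · simpa using htan y _
    · simpa using hnor y
  set K : (ι → ℝ) × ℝ → V := fun z => if 0 ≤ z.2 then H z else 0 with hK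
  set K' : (ι → ℝ) × ℝ → ((ι → ℝ) × ℝ →L[ℝ] V) := fun z => if 0 ≤ z.2 then fderiv ℝ H z else 0
    with hK'
  have hKd : ∀ z, HasFDerivAt K (K' z) z := by
    rintro ⟨y, r⟩
    rcases lt_trichotomy r 0 with hr | rfl | hr
    · have : K =ᶠ[𝓝 (y, r)] fun _ => 0 := by
        filter_upwards [(isOpen_Iio.preimage continuous_snd).mem_nhds (show r ∈ Iio 0 from hr)]
          with z hz using if_neg (not_le.2 hz)
      simp only [hK', if_neg (not_le.2 hr)]
      exact (hasFDerivAt_const _ _).congr_of_eventuallyEq this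
    -- On the hyperplane `H` has zero derivative and `‖K‖ ≤ ‖H‖`, so `K` inherits the little-o
    -- estimate.
    · have h := (hd (y, 0)).hasFDerivAt
      simp only [hK', le_refl, if_true]
      rw [hfd] at h ⊢
      rw [hasFDerivAt_iff_isLittleO_nhds_zero] at h ⊢
      refine (Asymptotics.isBigO_of_le _ fun z => ?_).trans_isLittleO h
      simp only [hK, h0]
      split_ifs <;> simp
    · have : K =ᶠ[𝓝 (y, r)] H := by
        filter_upwards [(isOpen_Ioi.preimage continuous_snd).mem_nhds (show r ∈ Ioi 0 from hr)]
          with z hz using if_pos (le_of_lt hz)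
      simp only [hK', if_pos hr.le]
      exact (hd _).hasFDerivAt.congr_of_eventuallyEq this
  have hK'c : Continuous K' := by
    refine Continuous.if_le (hH.continuous_fderiv one_ne_zero) continuous_const continuous_const
      continuous_snd ?_
    rintro ⟨y, r⟩ (rfl : 0 = r)
    exact hfd y
  have hKc : ContDiff ℝ 1 K := contDiff_one_iff_hasFDerivAt.2 ⟨K', hK'c, hKd⟩
  set T : (Option ι → ℝ) →L[ℝ] (ι → ℝ) × ℝ :=
    (ContinuousLinearMap.pi fun i => ContinuousLinearMap.proj (some i)).prod
      (ContinuousLinearMap.proj none) with hT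
  -- The shift moves the hyperplane to `x none = 1`, so that `u` vanishes on the ball `|x|^2 ≤ 1/2`;
  -- the point `(y, r)` becomes `(y, r + 1)`.
  set u : (Option ι → ℝ) → V := fun x => K (T x - (0, 1)) with hu
  have huc : ContDiff ℝ 1 u := hKc.comp (T.contDiff.sub contDiff_const)
  have hfu : ∀ x v, fderiv ℝ u x v = K' (T x - (0, 1)) (T v) := fun x v => by
    have h1 : HasFDerivAt u ((K' (T x - (0, 1))).comp T) x :=
      (hKd _).comp x (T.hasFDerivAt.sub_const _)
    rw [h1.fderiv]
    rfl
  have hTs : ∀ i, T (Pi.single (some i) 1) = (Pi.single i 1, 0) := fun i => by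
    refine Prod.ext (funext fun j => ?_) ?_ <;> simp [hT, Pi.single_apply]
  have hTn : T (Pi.single none 1) = (0, 1) := by
    refine Prod.ext (funext fun j => ?_) ?_ <;> simp [hT]
  have hall := eq_zero_of_factorsLaplacian hE huc (fun x => ?_) (δ := 1 / 2) (by norm_num)
    (fun x hx => ?_) (fun o => o.elim (r + 1) y)
  · simpa [hu, hT, hK, hr] using hall
  · simp only [Fintype.sum_option, hfu, hTs, hTn, hK']
    split_ifs
    · rw [add_comm]
      exact hLH _
    · simp
  · rw [Fintype.sum_option] at hx
    have : 0 ≤ ∑ i, x (some i) ^ 2 := Finset.sum_nonneg fun _ _ => sq_nonneg _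
    have hlt : x none < 1 := by nlinarith
    simp [hu, hT, hK, hlt]

end PartialSlice

/-! ### Iterated Laplacians of polynomial functions. -/

namespace PartialSlice

open Filter Topology Set
open scoped ContDiff Nat

section Polynomial

variable {ι : Type*} [Fintype ι] [DecidableEq ι] {V : Type*} [NormedAddCommGroup V]
  [NormedSpace ℝ V]

/-- The partial derivative `∂_i f`. -/
noncomputable def partialDeriv (i : ι) (f : (ι → ℝ) → V) (x : ι → ℝ) : V :=
  lineDeriv ℝ f x (Pi.single i 1)

lemma hasLineDerivAt_partialDeriv {f : (ι → ℝ) → V} (hf : ContDiff ℝ ∞ f) (i : ι) (x : ι → ℝ) :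
    HasLineDerivAt ℝ f (partialDeriv i f x) x (Pi.single i 1) :=
  ((hf.differentiable (by simp)) x).lineDifferentiableAt.hasLineDerivAt

lemma contDiff_partialDeriv {f : (ι → ℝ) → V} (hf : ContDiff ℝ ∞ f) (i : ι) :
    ContDiff ℝ ∞ (partialDeriv i f) := by
  have : partialDeriv i f = fun x => fderiv ℝ f x (Pi.single i 1) :=
    funext fun x => ((hf.differentiable (by simp)) x).lineDeriv_eq_fderiv
  rw [this]
  exact (hf.fderiv_right (m := ∞) (by simp)).clm_apply contDiff_const

lemma partialDeriv_sum {κ : Type*} (S : Finset κ) {f : κ → (ι → ℝ) → V}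
    (hf : ∀ k ∈ S, ContDiff ℝ ∞ (f k)) (i : ι) :
    partialDeriv i (fun x => ∑ k ∈ S, f k x) = fun x => ∑ k ∈ S, partialDeriv i (f k) x :=
  funext fun x => HasLineDerivAt.lineDeriv
    (HasDerivAt.fun_sum fun k hk => hasLineDerivAt_partialDeriv (hf k hk) i x)

lemma partialDeriv_clm (L : V →L[ℝ] V) {f : (ι → ℝ) → V} (hf : ContDiff ℝ ∞ f) (i : ι) :
    partialDeriv i (fun x => L (f x)) = fun x => L (partialDeriv i f x) :=
  funext fun x => HasLineDerivAt.lineDeriv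
    (L.hasFDerivAt.comp_hasDerivAt (0 : ℝ) (hasLineDerivAt_partialDeriv hf i x))

lemma partialDeriv_comm {f : (ι → ℝ) → V} (hf : ContDiff ℝ ∞ f) (i j : ι) :
    partialDeriv i (partialDeriv j f) = partialDeriv j (partialDeriv i f) :=
  funext fun x => lineDeriv_lineDeriv_comm (hf.of_le (by norm_cast)) x _ _

/-- Smooth functions all of whose partial derivatives of order `d` vanish. -/
def IsPolyLT : ℕ → ((ι → ℝ) → V) → Prop
  | 0, f => f = 0
  | d + 1, f => ContDiff ℝ ∞ f ∧ ∀ i, IsPolyLT d (partialDeriv i f)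

lemma IsPolyLT.contDiff {d : ℕ} {f : (ι → ℝ) → V} (hf : IsPolyLT d f) : ContDiff ℝ ∞ f := by
  cases d with
  | zero => rw [show f = 0 from hf]; exact contDiff_const
  | succ d => exact hf.1

lemma IsPolyLT.zero (d : ℕ) : IsPolyLT d (fun _ => 0 : (ι → ℝ) → V) := by
  induction d with
  | zero => rfl
  | succ d ih =>
    refine ⟨contDiff_const, fun i => ?_⟩
    convert ih using 2
    simp [partialDeriv, lineDeriv]

lemma IsPolyLT.succ {d : ℕ} {f : (ι → ℝ) → V} (hf : IsPolyLT d f) : IsPolyLT (d + 1) f := by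
  induction d generalizing f with
  | zero => rw [show f = fun _ => 0 from hf]; exact IsPolyLT.zero 1
  | succ d ih => exact ⟨hf.1, fun i => ih (hf.2 i)⟩

lemma IsPolyLT.sum {κ : Type*} {S : Finset κ} {d : ℕ} {f : κ → (ι → ℝ) → V}
    (hf : ∀ k ∈ S, IsPolyLT d (f k)) : IsPolyLT d fun x => ∑ k ∈ S, f k x := by
  induction d generalizing f with
  | zero => exact funext fun x => Finset.sum_eq_zero fun k hk => congrFun (hf k hk) x
  | succ d ih =>
    refine ⟨ContDiff.sum fun k hk => (hf k hk).1, fun i => ?_⟩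
    rw [partialDeriv_sum S (fun k hk => (hf k hk).1)]
    exact ih fun k hk => (hf k hk).2 i

lemma IsPolyLT.clm (L : V →L[ℝ] V) {d : ℕ} {f : (ι → ℝ) → V} (hf : IsPolyLT d f) :
    IsPolyLT d fun x => L (f x) := by
  induction d generalizing f with
  | zero => exact funext fun x => by simp [show f = 0 from hf]
  | succ d ih =>
    refine ⟨L.contDiff.comp hf.1, fun i => ?_⟩
    rw [partialDeriv_clm L hf.1]
    exact ih (hf.2 i)

lemma isPolyLT_eval_smul {k d : ℕ} (hk : k < d) {Q : MvPolynomial ι ℝ} (hQ : Q.IsHomogeneous k)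
    (a : V) : IsPolyLT d fun x : ι → ℝ => MvPolynomial.eval x Q • a := by
  induction d generalizing k Q with
  | zero => omega
  | succ d ih =>
    refine ⟨(contDiff_eval Q).smul contDiff_const, fun i => ?_⟩
    have h : partialDeriv i (fun x : ι → ℝ => MvPolynomial.eval x Q • a) =
        fun x => MvPolynomial.eval x (Q.pderiv i) • a := funext fun x =>
      HasLineDerivAt.lineDeriv (HasDerivAt.smul_const (hasLineDerivAt_eval Q x i) a)
    rw [h]
    rcases Nat.eq_zero_or_pos k with rfl | hk0
    · rw [← MvPolynomial.totalDegree_zero_iff_isHomogeneous,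
        MvPolynomial.totalDegree_eq_zero_iff_eq_C] at hQ
      rw [hQ]
      simpa using IsPolyLT.zero d
    · exact ih (by omega) hQ.pderiv

end Polynomial

section Operators

variable {A : Type*} [NormedNonAssocRing A] [NormedSpace ℝ A] {p : ℕ}

lemma negLaplacian_eq (f : (Fin (p + 1) → ℝ) → A) :
    negLaplacian f = fun y => -∑ i, partialDeriv i (partialDeriv i f) y := rfl

lemma IsPolynomialFun.isPolyLT {f : (Fin (p + 1) → ℝ) → A} (hf : IsPolynomialFun f) :
    ∃ d, IsPolyLT d f := by
  obtain ⟨c, hc⟩ := hf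
  refine ⟨c.support.sup (fun k => k.degree) + 1, ?_⟩
  rw [show f = _ from funext hc]
  refine IsPolyLT.sum fun k hk => ?_
  have h := isPolyLT_eval_smul (Nat.lt_succ_of_le (Finset.le_sup (f := fun k => k.degree) hk))
    (MvPolynomial.isHomogeneous_monomial (1 : ℝ) (d := k) rfl) (c k)
  simpa [MvPolynomial.eval_monomial, Finsupp.prod_fintype] using h

lemma contDiff_negLaplacian {f : (Fin (p + 1) → ℝ) → A} (hf : ContDiff ℝ ∞ f) :
    ContDiff ℝ ∞ (negLaplacian f) :=
  (ContDiff.sum fun i _ => contDiff_partialDeriv (contDiff_partialDeriv hf i) i).neg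

lemma contDiff_negLaplacian_iterate {f : (Fin (p + 1) → ℝ) → A} (hf : ContDiff ℝ ∞ f) (k : ℕ) :
    ContDiff ℝ ∞ (negLaplacian^[k] f) := by
  induction k with
  | zero => exact hf
  | succ k ih =>
    rw [Function.iterate_succ_apply']
    exact contDiff_negLaplacian ih

/-- The order actually drops by two; dropping by one suffices for termination of the series. -/
lemma IsPolyLT.negLaplacian {d : ℕ} {f : (Fin (p + 1) → ℝ) → A} (hf : IsPolyLT (d + 1) f) :
    IsPolyLT d (negLaplacian f) := by
  rw [negLaplacian_eq]
  refine IsPolyLT.clm (-ContinuousLinearMap.id ℝ A)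
    (f := fun y => ∑ i, PartialSlice.partialDeriv i (PartialSlice.partialDeriv i f) y)
    (IsPolyLT.sum fun i _ => ?_)
  cases d with
  | zero =>
    have h : PartialSlice.partialDeriv i f = fun _ => 0 := hf.2 i
    have := (IsPolyLT.zero (V := A) (ι := Fin (p + 1)) 1).2 i
    rwa [← h] at this
  | succ d => exact ((hf.2 i).2 i).succ

lemma IsPolyLT.negLaplacian_iterate {d k : ℕ} {f : (Fin (p + 1) → ℝ) → A}
    (hf : IsPolyLT d f) (hk : d ≤ k) : PartialSlice.negLaplacian^[k] f = 0 := by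
  have hzero : ∀ f : (Fin (p + 1) → ℝ) → A, IsPolyLT 0 f → IsPolyLT 0 (PartialSlice.negLaplacian f)
    := fun f hf => hf.succ.negLaplacian
  induction k generalizing d f with
  | zero =>
    obtain rfl : d = 0 := by omega
    exact hf
  | succ k ih =>
    rw [Function.iterate_succ_apply]
    cases d with
    | zero => exact ih (hzero f hf) (Nat.zero_le _)
    | succ d => exact ih hf.negLaplacian (by omega)

lemma negLaplacian_clm (L : A →L[ℝ] A) {f : (Fin (p + 1) → ℝ) → A} (hf : ContDiff ℝ ∞ f) :
    negLaplacian (fun y => L (f y)) = fun y => L (negLaplacian f y) := by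
  simp only [negLaplacian_eq, partialDeriv_clm L hf,
    partialDeriv_clm L (contDiff_partialDeriv hf _), map_neg, map_sum]

lemma negLaplacian_sum {κ : Type*} (S : Finset κ) {f : κ → (Fin (p + 1) → ℝ) → A}
    (hf : ∀ k ∈ S, ContDiff ℝ ∞ (f k)) :
    negLaplacian (fun y => ∑ k ∈ S, f k y) = fun y => ∑ k ∈ S, negLaplacian (f k) y := by
  simp only [negLaplacian_eq, partialDeriv_sum S hf,
    partialDeriv_sum S fun k hk => contDiff_partialDeriv (hf k hk) _]
  funext y
  rw [Finset.sum_comm, Finset.sum_neg_distrib]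

lemma negLaplacian_partialDeriv {f : (Fin (p + 1) → ℝ) → A} (hf : ContDiff ℝ ∞ f)
    (i : Fin (p + 1)) : negLaplacian (partialDeriv i f) = partialDeriv i (negLaplacian f) := by
  have h1 : ∀ j, partialDeriv j (partialDeriv j (partialDeriv i f)) =
      partialDeriv i (partialDeriv j (partialDeriv j f)) := fun j => by
    rw [partialDeriv_comm hf, partialDeriv_comm (contDiff_partialDeriv hf j)]
  have h2 := partialDeriv_clm (-ContinuousLinearMap.id ℝ A)
    (f := fun y => ∑ j, partialDeriv j (partialDeriv j f) y)
    (ContDiff.sum fun j _ => contDiff_partialDeriv (contDiff_partialDeriv hf j) j) i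
  rw [partialDeriv_sum _ fun j _ => contDiff_partialDeriv (contDiff_partialDeriv hf j) j] at h2
  simp only [negLaplacian_eq, h1]
  exact h2.symm

end Operators

end PartialSlice

/-! ### Clifford-type relations in an alternative algebra. -/

namespace PartialSlice

open Filter Topology Set
open scoped Nat

section Alternative

variable {A : Type*} [NormedNonAssocRing A] [NormedSpace ℝ A]
    [IsScalarTower ℝ A A] [SMulCommClass ℝ A A]

-- Polarization of `a (a x) = (a a) x`. This is the only use of alternativity: it lets relations
-- between elements act as relations between left multiplications.
omit [NormedSpace ℝ A] [IsScalarTower ℝ A A] [SMulCommClass ℝ A A] in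
lemma mul_mul_add_mul_mul [IsAlternativeRing A] (a b x : A) :
    a * (b * x) + b * (a * x) = (a * b + b * a) * x := by
  have h1 := IsAlternativeRing.left_alternative (a + b) x
  have h2 := IsAlternativeRing.left_alternative a x
  have h3 := IsAlternativeRing.left_alternative b x
  rw [associator_apply, sub_eq_zero] at h1 h2 h3
  simp only [add_mul, mul_add, h2, h3] at h1 ⊢
  linear_combination (norm := abel) -h1

/-- Left multiplication by `a` as a continuous linear map. -/
noncomputable def leftMul [FiniteDimensional ℝ A] (a : A) : A →L[ℝ] A :=
  LinearMap.toContinuousLinearMap (LinearMap.mulLeft ℝ a)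

omit [IsScalarTower ℝ A A] in
lemma leftMul_apply [FiniteDimensional ℝ A] (a x : A) : leftMul a x = a * x := rfl

variable [StarRing A] {M : Submodule ℝ A} {m p : ℕ} (hp : p < m)
  {v : Module.Basis (Fin (m + 1)) ℝ M}

omit [IsScalarTower ℝ A A] [SMulCommClass ℝ A A] in
lemma IsHypercomplexBasis.mul_add_mul_basis (hv : IsHypercomplexBasis v) {s t : Fin (m + 1)}
    (hs : s ≠ 0) (ht : t ≠ 0) :
    (v s : A) * v t + v t * v s = (if s = t then (-2 : ℝ) else 0) • (1 : A) := by
  split_ifs with h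
  · subst h
    obtain ⟨h1, h2⟩ := hv.mem_imaginaryUnits s hs
    rw [eq_neg_of_add_eq_zero_right h1, mul_neg] at h2
    rw [← neg_neg ((v s : A) * v s), h2, neg_smul, two_smul]
    abel
  · rw [hv.anticomm s t hs ht h, zero_smul, neg_add_cancel]

/-- Bilinear extension of the basis relations. It is needed because `ω` is a general unit vector of
the tail, not a basis vector. -/
lemma IsHypercomplexBasis.mul_add_mul (hv : IsHypercomplexBasis v) {x y : M}
    (hx : v.repr x 0 = 0) (hy : v.repr y 0 = 0) :
    (x : A) * y + y * x = (-2 * ∑ s, v.repr x s * v.repr y s : ℝ) • (1 : A) := by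
  have hc : ∀ z : M, (z : A) = ∑ s, v.repr z s • (v s : A) := fun z => by
    have h := congrArg M.subtype (v.sum_repr z)
    rw [map_sum] at h
    exact h.symm
  rw [hc x, hc y, Finset.sum_mul_sum, Finset.sum_mul_sum, Finset.sum_comm (γ := Fin (m + 1)),
    ← Finset.sum_add_distrib, Finset.mul_sum, Finset.sum_smul]
  refine Finset.sum_congr rfl fun t _ => ?_
  rw [← Finset.sum_add_distrib, Finset.sum_eq_single t]
  · rcases eq_or_ne t 0 with rfl | ht
    · simp [hx]
    · have h := hv.mul_add_mul_basis ht ht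
      rw [if_pos rfl] at h
      simp only [smul_mul_smul_comm]
      rw [mul_comm (v.repr y t), ← smul_add, h, smul_smul, mul_comm]
  · intro s _ hst
    rcases eq_or_ne t 0 with rfl | ht
    · simp [hy]
    rcases eq_or_ne s 0 with rfl | hs
    · simp [hx]
    have h := hv.mul_add_mul_basis hs ht
    rw [if_neg hst, zero_smul] at h
    simp only [smul_mul_smul_comm]
    rw [mul_comm (v.repr y t), ← smul_add, h, smul_zero]
  · simp

/-- The orthonormal family `v_0, …, v_p, ω`. -/
noncomputable def sliceFrame (v : Module.Basis (Fin (m + 1)) ℝ M) (ω : M) :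
    Option (Fin (p + 1)) → M
  | none => ω
  | some i => v (idx hp i)

/-- The family `v_0, -v_1, …, -v_p, -ω`. -/
noncomputable def sliceFrameConj (v : Module.Basis (Fin (m + 1)) ℝ M) (ω : M)
    (o : Option (Fin (p + 1))) : M :=
  if o = some 0 then sliceFrame hp v ω o else -sliceFrame hp v ω o

omit [IsScalarTower ℝ A A] [SMulCommClass ℝ A A] [StarRing A] in
lemma sum_repr_sliceFrame {ω : M} (hω : ω ∈ unitSphere v p) (a b : Option (Fin (p + 1))) :
    ∑ s, v.repr (sliceFrame hp v ω a) s * v.repr (sliceFrame hp v ω b) s =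
      if a = b then 1 else 0 := by
  have hωi : ∀ i : Fin (p + 1), v.repr ω (idx hp i) = 0 := fun i =>
    hω.1 _ (by rw [idx_val]; omega)
  have hidx : ∀ i j : Fin (p + 1), (idx hp i = idx hp j) = (i = j) := fun i j => by
    simp [Fin.ext_iff, idx_val]
  rcases a with _ | i <;> rcases b with _ | j
  · rw [if_pos rfl, ← hω.2]
    symm
    simp only [← sq]
    refine Finset.sum_subset (Finset.subset_univ _) fun s _ hs => ?_
    simp [hω.1 s (by simpa using hs)]
  · simp [sliceFrame, Finsupp.single_apply, hωi]
  · simp [sliceFrame, Finsupp.single_apply, hωi]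
  · simp [sliceFrame, Finsupp.single_apply, hidx, eq_comm]

omit [IsScalarTower ℝ A A] [SMulCommClass ℝ A A] [StarRing A] in
lemma repr_sliceFrame_zero {ω : M} (hω : ω ∈ unitSphere v p) {a : Option (Fin (p + 1))}
    (ha : a ≠ some 0) : v.repr (sliceFrame hp v ω a) 0 = 0 := by
  rcases a with _ | i
  · exact hω.1 0 (by simp)
  · have : idx hp i ≠ 0 := fun h =>
      ha (congrArg some (Fin.ext (show (idx hp i : ℕ) = 0 from congrArg Fin.val h)))
    simp [sliceFrame, this]

omit [IsScalarTower ℝ A A] [SMulCommClass ℝ A A] in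
lemma IsHypercomplexBasis.sliceFrame_some_zero (hv : IsHypercomplexBasis v) (ω : M) :
    (sliceFrame hp v ω (some 0) : A) = 1 := hv.zero_eq

variable [IsAlternativeRing A] [FiniteDimensional ℝ A]

/-- For two imaginary frame vectors this is orthonormality combined with `mul_mul_add_mul_mul`.
Pairs involving `v_0 = 1` work because conjugation fixes `1` and negates the others. -/
lemma IsHypercomplexBasis.factorsLaplacian (hv : IsHypercomplexBasis v) {ω : M}
    (hω : ω ∈ unitSphere v p) :
    FactorsLaplacian (fun a => leftMul (sliceFrame hp v ω a : A))
      (fun a => leftMul (sliceFrameConj hp v ω a : A)) := by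
  intro a b x
  simp only [leftMul_apply]
  by_cases ha : a = some 0 <;> by_cases hb : b = some 0
  · subst ha; subst hb
    simp [sliceFrameConj, hv.sliceFrame_some_zero, two_smul]
  · subst ha
    simp [sliceFrameConj, hv.sliceFrame_some_zero, hb, Ne.symm hb]
  · subst hb
    simp [sliceFrameConj, hv.sliceFrame_some_zero, ha]
  · have h := mul_mul_add_mul_mul (sliceFrame hp v ω b : A) (sliceFrame hp v ω a : A) x
    rw [hv.mul_add_mul (repr_sliceFrame_zero hp hω hb) (repr_sliceFrame_zero hp hω ha),
      sum_repr_sliceFrame hp hω] at h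
    simp only [sliceFrameConj, if_neg ha, if_neg hb, Submodule.coe_neg, neg_mul, ← neg_add, h,
      smul_mul_assoc, one_mul]
    rcases eq_or_ne a b with rfl | hab
    · simp
    · simp [hab, hab.symm]

lemma IsHypercomplexBasis.mul_mul_sphere (hp : p < m) (hv : IsHypercomplexBasis v) {ω : M}
    (hω : ω ∈ unitSphere v p) (x : A) : (ω : A) * (ω * x) = -x := by
  have h := hv.factorsLaplacian hp hω none none x
  simp only [leftMul_apply, sliceFrameConj, sliceFrame, reduceCtorEq, if_false, if_true,
    Submodule.coe_neg, neg_mul, ← two_smul ℝ] at h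
  exact neg_eq_iff_eq_neg.1 (smul_right_injective A (two_ne_zero' ℝ) h)

/-- `v_i (ω (v_j x)) + v_j (ω (v_i x)) = 2 δ_ij ω x`. -/
lemma IsHypercomplexBasis.mul_sphere_mul (hv : IsHypercomplexBasis v) {ω : M}
    (hω : ω ∈ unitSphere v p) (i j : Fin (p + 1)) (x : A) :
    (v (idx hp i) : A) * (ω * (v (idx hp j) * x)) + v (idx hp j) * (ω * (v (idx hp i) * x)) =
      if i = j then (2 : ℝ) • ((ω : A) * x) else 0 := by
  -- Moving `ω` to the left past `v_i` conjugates `v_i`; what remains inside `ω` is the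
  -- factorization identity.
  have hcomm : ∀ (i : Fin (p + 1)) (z : A), (v (idx hp i) : A) * (ω * z) =
      ω * (sliceFrameConj hp v ω (some i) * z) := fun i z => by
    by_cases hi : i = 0
    · subst hi
      have : (v (idx hp 0) : A) = 1 := hv.zero_eq
      simp [sliceFrameConj, sliceFrame, this]
    · have h := hv.factorsLaplacian hp hω (some i) none z
      simp only [leftMul_apply, sliceFrameConj, sliceFrame, reduceCtorEq, if_false,
        Option.some.injEq, hi, Submodule.coe_neg, neg_mul, ← neg_add] at h
      simp only [sliceFrameConj, sliceFrame, Option.some.injEq, hi, if_false, Submodule.coe_neg,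
        neg_mul, mul_neg]
      rw [neg_eq_zero, add_comm] at h
      exact eq_neg_of_add_eq_zero_left h
  have h := congrArg (leftMul (ω : A)) (hv.factorsLaplacian hp hω (some j) (some i) x)
  simp only [leftMul_apply, sliceFrame, mul_add, Option.some.injEq] at h
  rw [hcomm, hcomm, h]
  rcases eq_or_ne i j with rfl | hij
  · simp [mul_smul_comm]
  · simp [hij, hij.symm]

end Alternative

end PartialSlice

/-! ### The Dirac operator on slices and the Cauchy-Kovalevskaya series. -/

namespace PartialSlice

open Filter Topology Set
open scoped Nat

section Dirac

variable {A : Type*} [NormedNonAssocRing A] [NormedSpace ℝ A]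
    [IsScalarTower ℝ A A] [SMulCommClass ℝ A A] [FiniteDimensional ℝ A]
    {M : Submodule ℝ A} {m p : ℕ} (hp : p < m) (v : Module.Basis (Fin (m + 1)) ℝ M)

omit [IsScalarTower ℝ A A] in
lemma diracHead_eq (f : (Fin (p + 1) → ℝ) → A) :
    diracHead hp v f = fun y => ∑ i, leftMul (v (idx hp i) : A) (partialDeriv i f y) := rfl

omit [IsScalarTower ℝ A A] in
lemma contDiff_diracHead {f : (Fin (p + 1) → ℝ) → A} (hf : ContDiff ℝ (⊤ : ℕ∞) f) :
    ContDiff ℝ (⊤ : ℕ∞) (diracHead hp v f) :=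
  ContDiff.sum fun i _ => (leftMul (v (idx hp i) : A)).contDiff.comp (contDiff_partialDeriv hf i)

omit [IsScalarTower ℝ A A] in
lemma negLaplacian_diracHead {f : (Fin (p + 1) → ℝ) → A} (hf : ContDiff ℝ (⊤ : ℕ∞) f) :
    negLaplacian (diracHead hp v f) = diracHead hp v (negLaplacian f) := by
  rw [diracHead_eq, diracHead_eq, negLaplacian_sum _
    (f := fun i y => leftMul (v (idx hp i) : A) (partialDeriv i f y)) fun i _ =>
    (leftMul (v (idx hp i) : A)).contDiff.comp (contDiff_partialDeriv hf i)]
  simp only [negLaplacian_clm _ (contDiff_partialDeriv hf _), negLaplacian_partialDeriv hf]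

omit [IsScalarTower ℝ A A] in
lemma negLaplacian_iterate_diracHead {f : (Fin (p + 1) → ℝ) → A} (hf : ContDiff ℝ (⊤ : ℕ∞) f)
    (k : ℕ) : negLaplacian^[k] (diracHead hp v f) = diracHead hp v (negLaplacian^[k] f) := by
  induction k with
  | zero => rfl
  | succ k ih =>
    rw [Function.iterate_succ_apply', Function.iterate_succ_apply', ih,
      negLaplacian_diracHead hp v (contDiff_negLaplacian_iterate hf k)]

variable {v} in
/-- `D (ω D f) = ω Δ f`. -/
lemma IsHypercomplexBasis.diracHead_mul_diracHead [StarRing A] [IsAlternativeRing A]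
    (hv : IsHypercomplexBasis v) {ω : M} (hω : ω ∈ unitSphere v p) {f : (Fin (p + 1) → ℝ) → A}
    (hf : ContDiff ℝ (⊤ : ℕ∞) f) (y : Fin (p + 1) → ℝ) :
    diracHead hp v (fun y => (ω : A) * diracHead hp v f y) y = -((ω : A) * negLaplacian f y) := by
  have h1 : ∀ i, partialDeriv i (fun y => leftMul (ω : A) (diracHead hp v f y)) =
      fun y => ∑ j, leftMul (ω : A) (leftMul (v (idx hp j) : A)
        (partialDeriv i (partialDeriv j f) y)) := fun i => by
    rw [partialDeriv_clm _ (contDiff_diracHead hp v hf), diracHead_eq,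
      partialDeriv_sum _ (f := fun j y => leftMul (v (idx hp j) : A) (partialDeriv j f y))
        fun j _ => (leftMul (v (idx hp j) : A)).contDiff.comp (contDiff_partialDeriv hf j)]
    simp only [partialDeriv_clm _ (contDiff_partialDeriv hf _), map_sum]
  have h2 : diracHead hp v (fun y => (ω : A) * diracHead hp v f y) y =
      ∑ i, ∑ j, (v (idx hp i) : A) * (ω * (v (idx hp j) *
        partialDeriv i (partialDeriv j f) y)) := by
    change ∑ i, leftMul (v (idx hp i) : A)
      (partialDeriv i (fun y => leftMul (ω : A) (diracHead hp v f y)) y) = _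
    simp only [h1, map_sum]
    rfl
  -- Doubling allows the double sum to be added to its transpose, after which `mul_sphere_mul`
  -- leaves only the diagonal.
  refine smul_right_injective A (two_ne_zero' ℝ) ?_
  simp only
  rw [two_smul, h2]
  conv_lhs => arg 2; rw [Finset.sum_comm]
  simp only [← Finset.sum_add_distrib]
  have h3 : ∀ i j : Fin (p + 1), (v (idx hp i) : A) * (ω * (v (idx hp j) *
      partialDeriv i (partialDeriv j f) y)) + (v (idx hp j) : A) * (ω * (v (idx hp i) *
      partialDeriv j (partialDeriv i f) y)) =
      if i = j then (2 : ℝ) • ((ω : A) * partialDeriv i (partialDeriv j f) y) else 0 := fun i j => by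
    rw [partialDeriv_comm hf j i, hv.mul_sphere_mul hp hω]
  simp only [h3, negLaplacian_eq, Finset.sum_ite_eq, Finset.mem_univ, if_true, mul_neg, neg_neg,
    Finset.mul_sum, Finset.smul_sum]

omit [IsScalarTower ℝ A A] in
lemma diracHead_sum {κ : Type*} (S : Finset κ) {f : κ → (Fin (p + 1) → ℝ) → A}
    (hf : ∀ k ∈ S, ContDiff ℝ (⊤ : ℕ∞) (f k)) (y : Fin (p + 1) → ℝ) :
    diracHead hp v (fun y => ∑ k ∈ S, f k y) y = ∑ k ∈ S, diracHead hp v (f k) y := by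
  simp only [diracHead_eq, partialDeriv_sum S hf, map_sum]
  exact Finset.sum_comm

omit [IsScalarTower ℝ A A] in
lemma diracHead_add {f g : (Fin (p + 1) → ℝ) → A} (hf : ContDiff ℝ (⊤ : ℕ∞) f)
    (hg : ContDiff ℝ (⊤ : ℕ∞) g) (y : Fin (p + 1) → ℝ) :
    diracHead hp v (fun y => f y + g y) y = diracHead hp v f y + diracHead hp v g y := by
  have h := diracHead_sum hp v Finset.univ (f := fun b : Bool => bif b then f else g)
    (fun b _ => by cases b <;> assumption) y
  simpa using h

omit [IsScalarTower ℝ A A] in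
lemma diracHead_smul (c : ℝ) {f : (Fin (p + 1) → ℝ) → A} (hf : ContDiff ℝ (⊤ : ℕ∞) f)
    (y : Fin (p + 1) → ℝ) :
    diracHead hp v (fun y => c • f y) y = c • diracHead hp v f y := by
  have h : ∀ i, partialDeriv i (fun y => c • f y) = fun y => c • partialDeriv i f y := fun i =>
    partialDeriv_clm (c • ContinuousLinearMap.id ℝ A) hf i
  simp only [diracHead_eq, h, map_smul, Finset.smul_sum]

-- Passes from derivatives of partial functions to the Fréchet form used in
-- `eq_zero_of_cauchy_data`.
omit [IsScalarTower ℝ A A] [SMulCommClass ℝ A A] [FiniteDimensional ℝ A] in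
lemma diracSlice_eq_fderiv (ω : M) {F : (Fin (p + 1) → ℝ) × ℝ → A} (hF : Differentiable ℝ F)
    (z : (Fin (p + 1) → ℝ) × ℝ) :
    diracSlice hp v ω F z = ∑ i, (v (idx hp i) : A) * fderiv ℝ F z (Pi.single i 1, 0) +
      (ω : A) * fderiv ℝ F z (0, 1) := by
  obtain ⟨y, r⟩ := z
  have h1 : ∀ w, lineDeriv ℝ (fun y => F (y, r)) y w = fderiv ℝ F (y, r) (w, 0) := fun w => by
    rw [← (hF _).lineDeriv_eq_fderiv]
    simp [lineDeriv]
  have h2 : deriv (fun r => F (y, r)) r = fderiv ℝ F (y, r) (0, 1) :=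
    ((hF (y, r)).hasFDerivAt.comp_hasDerivAt r
      ((hasDerivAt_const r y).prodMk (hasDerivAt_id r))).deriv
  simp only [diracSlice, diracHead, h1, h2]

lemma hasDerivAt_pow_div_factorial (n : ℕ) (r : ℝ) :
    HasDerivAt (fun r : ℝ => r ^ (n + 1) / ((n + 1)! : ℝ)) (r ^ n / (n ! : ℝ)) r := by
  refine ((hasDerivAt_pow (n + 1) r).div_const _).congr_deriv ?_
  rw [Nat.factorial_succ]
  have : (n ! : ℝ) ≠ 0 := by positivity
  push_cast
  field_simp

end Dirac

section Series

variable {A : Type*} [NormedNonAssocRing A] [NormedSpace ℝ A]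
    {M : Submodule ℝ A} {m p : ℕ} (hp : p < m) (v : Module.Basis (Fin (m + 1)) ℝ M)

lemma neg_mem_unitSphere {ω : M} (hω : ω ∈ unitSphere v p) : -ω ∈ unitSphere v p :=
  ⟨fun s hs => by simp [hω.1 s hs], by simpa using hω.2⟩

lemma ckSeries_neg (f₀ : (Fin (p + 1) → ℝ) → A) (y : Fin (p + 1) → ℝ) (r : ℝ) (ω : M) :
    ckSeries hp v f₀ y (-r) (-ω) = ckSeries hp v f₀ y r ω := by
  have h1 : ckEvenTerm f₀ y (-r) = ckEvenTerm f₀ y r := funext fun k => by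
    simp [ckEvenTerm, pow_mul]
  have h2 : ckOddTerm hp v f₀ y (-r) = fun k => -ckOddTerm hp v f₀ y r k := funext fun k => by
    simp [ckOddTerm, pow_mul, pow_succ, neg_div]
  simp [ckSeries, h1, h2, tsum_neg]

/-- Slices are full copies of `ℝ^{p+2}`, so negative `r` is needed as well: there `r ω = (-r)(-ω)`,
and `ckSeries_neg` applies. -/
lemma CK_slicePoint_real (f₀ : (Fin (p + 1) → ℝ) → A) (z : (Fin (p + 1) → ℝ) × ℝ)
    {ω : M} (hω : ω ∈ unitSphere v p) :
    CK hp v f₀ (slicePoint hp v ω z) = ckSeries hp v f₀ z.1 z.2 ω := by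
  obtain ⟨y, r⟩ := z
  rcases le_total 0 r with hr | hr
  · exact CK_slicePoint hp v f₀ y hr hω
  · have h := CK_slicePoint hp v f₀ y (neg_nonneg.2 hr) (neg_mem_unitSphere v hω)
    rw [ckSeries_neg] at h
    rw [← h]
    simp [slicePoint]

lemma ckSeries_zero (f₀ : (Fin (p + 1) → ℝ) → A) (y : Fin (p + 1) → ℝ) (ω : M) :
    ckSeries hp v f₀ y 0 ω = f₀ y := by
  have h1 : ckOddTerm hp v f₀ y 0 = fun _ => 0 := funext fun k => by simp [ckOddTerm]
  rw [ckSeries, h1, tsum_zero, mul_zero, add_zero, tsum_eq_single 0]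
  · simp [ckEvenTerm]
  · intro k hk
    simp [ckEvenTerm, hk]

include hp in
lemma exists_mem_unitSphere : ∃ ω : M, ω ∈ unitSphere v p := by
  refine ⟨v (Fin.last m), fun s hs => ?_, ?_⟩
  · have : Fin.last m ≠ s := fun h => by
      have := congrArg Fin.val h
      simp at this
      omega
    simp [this]
  · rw [Finset.sum_eq_single (Fin.last m)]
    · simp
    · intro s _ hs
      simp [hs.symm]
    · simp [hp]

lemma repr_tailPart (x : M) (s : Fin (m + 1)) :
    v.repr (tailPart v p x) s = if p < (s : ℕ) then v.repr x s else 0 := by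
  simp [tailPart, Finsupp.single_apply]

lemma inclusion_add_tailPart (x : M) :
    inclusion hp v (headPart hp v x) + tailPart v p x = x := by
  refine v.repr.injective (Finsupp.ext fun s => ?_)
  rw [map_add, Finsupp.add_apply, repr_tailPart]
  split_ifs with hs
  · rw [repr_inclusion_tail hp v _ s hs, zero_add]
  · have : s = idx hp ⟨s, by omega⟩ := Fin.ext rfl
    rw [add_zero, this, repr_inclusion_head]
    rfl

lemma exists_slicePoint_eq (x : M) :
    ∃ ω ∈ unitSphere v p, ∃ y r, 0 ≤ r ∧ slicePoint hp v ω (y, r) = x := by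
  have hnn : 0 ≤ ∑ s ∈ Finset.univ.filter (fun s : Fin (m + 1) => p < (s : ℕ)),
    (v.repr x s) ^ 2 := Finset.sum_nonneg fun _ _ => sq_nonneg _
  have hsq : tailRadius v p x ^ 2 = ∑ s ∈ Finset.univ.filter (fun s : Fin (m + 1) => p < (s : ℕ)),
    (v.repr x s) ^ 2 := Real.sq_sqrt hnn
  have hr : 0 ≤ tailRadius v p x := Real.sqrt_nonneg _
  rcases hr.eq_or_lt with h0 | h0
  · obtain ⟨ω, hω⟩ := exists_mem_unitSphere hp v
    refine ⟨ω, hω, headPart hp v x, 0, le_rfl, ?_⟩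
    rw [← h0, zero_pow two_ne_zero, eq_comm,
      Finset.sum_eq_zero_iff_of_nonneg fun _ _ => sq_nonneg _] at hsq
    have ht : tailPart v p x = 0 := Finset.sum_eq_zero fun s hs => by
      rw [pow_eq_zero_iff two_ne_zero |>.1 (hsq s hs), zero_smul]
    conv_rhs => rw [← inclusion_add_tailPart hp v x, ht]
    simp [slicePoint]
  · refine ⟨(tailRadius v p x)⁻¹ • tailPart v p x, ⟨fun s hs => ?_, ?_⟩, headPart hp v x,
      tailRadius v p x, hr, ?_⟩
    · simp [repr_tailPart, not_lt.2 hs]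
    · rw [Finset.sum_congr rfl (g := fun s => (tailRadius v p x ^ 2)⁻¹ * (v.repr x s) ^ 2),
        ← Finset.mul_sum, ← hsq, inv_mul_cancel₀ (by positivity)]
      intro s hs
      simp [repr_tailPart, (Finset.mem_filter.1 hs).2, mul_pow]
    · simp only [slicePoint]
      rw [smul_inv_smul₀ h0.ne', inclusion_add_tailPart]

end Series

/-! ### The series solves the slice equation, and solutions are determined by their initial values.
-/

section Main

variable {A : Type*} [NormedNonAssocRing A] [NormedSpace ℝ A]
    [IsScalarTower ℝ A A] [SMulCommClass ℝ A A] [FiniteDimensional ℝ A]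
    {M : Submodule ℝ A} {m p : ℕ} (hp : p < m) {v : Module.Basis (Fin (m + 1)) ℝ M}

omit [IsScalarTower ℝ A A] [SMulCommClass ℝ A A] [FiniteDimensional ℝ A] in
lemma ckEvenTerm_eq_zero {f₀ : (Fin (p + 1) → ℝ) → A} {d k : ℕ} (hd : IsPolyLT d f₀) (hk : d ≤ k)
    (y : Fin (p + 1) → ℝ) (r : ℝ) : ckEvenTerm f₀ y r k = 0 := by
  simp [ckEvenTerm, hd.negLaplacian_iterate hk]

omit [IsScalarTower ℝ A A] in
lemma ckOddTerm_eq {f₀ : (Fin (p + 1) → ℝ) → A} (hf₀ : ContDiff ℝ (⊤ : ℕ∞) f₀) (k : ℕ)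
    (y : Fin (p + 1) → ℝ) (r : ℝ) : ckOddTerm hp v f₀ y r k =
      (r ^ (2 * k + 1) / ((2 * k + 1)! : ℝ)) • diracHead hp v (negLaplacian^[k] f₀) y := by
  rw [ckOddTerm, negLaplacian_iterate_diracHead hp v hf₀]

omit [IsScalarTower ℝ A A] in
lemma ckOddTerm_eq_zero {f₀ : (Fin (p + 1) → ℝ) → A} {d k : ℕ} (hd : IsPolyLT d f₀) (hk : d ≤ k)
    (y : Fin (p + 1) → ℝ) (r : ℝ) : ckOddTerm hp v f₀ y r k = 0 := by
  rw [ckOddTerm_eq hp hd.contDiff, hd.negLaplacian_iterate hk]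
  simp [diracHead, lineDeriv]

lemma ckSeries_eq_sum {f₀ : (Fin (p + 1) → ℝ) → A} {d : ℕ} (hd : IsPolyLT d f₀)
    (y : Fin (p + 1) → ℝ) (r : ℝ) (ω : M) : ckSeries hp v f₀ y r ω =
      ∑ k ∈ Finset.range d, (r ^ (2 * k) / ((2 * k)! : ℝ)) • (negLaplacian^[k] f₀) y +
      ∑ k ∈ Finset.range d, (r ^ (2 * k + 1) / ((2 * k + 1)! : ℝ)) •
        ((ω : A) * diracHead hp v (negLaplacian^[k] f₀) y) := by
  rw [ckSeries, tsum_eq_sum (s := Finset.range d) fun k hk => ckEvenTerm_eq_zero hd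
    (by simpa using hk) y r, tsum_eq_sum (s := Finset.range d) fun k hk => ckOddTerm_eq_zero hp hd
    (by simpa using hk) y r]
  simp only [ckOddTerm_eq hp hd.contDiff, Finset.mul_sum, mul_smul_comm]
  rfl

lemma contDiff_ckSeries {f₀ : (Fin (p + 1) → ℝ) → A} {d : ℕ} (hd : IsPolyLT d f₀) (ω : M) :
    ContDiff ℝ 1 fun z : (Fin (p + 1) → ℝ) × ℝ => ckSeries hp v f₀ z.1 z.2 ω := by
  simp only [ckSeries_eq_sum hp hd]
  refine ContDiff.of_le (n := ((⊤ : ℕ∞) : WithTop ℕ∞)) ?_ (by norm_cast)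
  refine (ContDiff.sum fun k _ => ?_).add (ContDiff.sum fun k _ => ?_)
  · exact ((contDiff_snd.pow _).div_const _).smul
      ((contDiff_negLaplacian_iterate hd.contDiff k).comp contDiff_fst)
  · exact ((contDiff_snd.pow _).div_const _).smul ((leftMul (ω : A)).contDiff.comp
      ((contDiff_diracHead hp v (contDiff_negLaplacian_iterate hd.contDiff k)).comp contDiff_fst))

lemma IsHypercomplexBasis.diracSlice_ckSeries [IsAlternativeRing A] [StarRing A]
    (hv : IsHypercomplexBasis v) {f₀ : (Fin (p + 1) → ℝ) → A} {d : ℕ} (hd : IsPolyLT d f₀) {ω : M}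
    (hω : ω ∈ unitSphere v p) (z : (Fin (p + 1) → ℝ) × ℝ) :
    diracSlice hp v ω (fun z => ckSeries hp v f₀ z.1 z.2 ω) z = 0 := by
  obtain ⟨y, r⟩ := z
  have hs := contDiff_negLaplacian_iterate hd.contDiff
  have hsD := fun k => contDiff_diracHead hp v (hs k)
  have hsω : ∀ k, ContDiff ℝ (⊤ : ℕ∞)
      fun y => (ω : A) * diracHead hp v (negLaplacian^[k] f₀) y := fun k =>
    (leftMul (ω : A)).contDiff.comp (hsD k)
  have hhead : diracHead hp v (fun y => ckSeries hp v f₀ y r ω) y =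
      ∑ k ∈ Finset.range d, (r ^ (2 * k) / ((2 * k)! : ℝ)) •
        diracHead hp v (negLaplacian^[k] f₀) y -
      ∑ k ∈ Finset.range d, (r ^ (2 * k + 1) / ((2 * k + 1)! : ℝ)) •
        ((ω : A) * (negLaplacian^[k + 1] f₀) y) := by
    simp only [ckSeries_eq_sum hp hd]
    rw [diracHead_add, diracHead_sum, diracHead_sum, sub_eq_add_neg, ← Finset.sum_neg_distrib]
    · congr 1
      · exact Finset.sum_congr rfl fun k _ => diracHead_smul hp v _ (hs k) y
      · refine Finset.sum_congr rfl fun k _ => ?_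
        rw [diracHead_smul hp v _ (hsω k), hv.diracHead_mul_diracHead hp hω (hs k), smul_neg,
          Function.iterate_succ_apply']
    · exact fun k _ => contDiff_const.smul (hsω k)
    · exact fun k _ => contDiff_const.smul (hs k)
    · exact ContDiff.sum fun k _ => contDiff_const.smul (hs k)
    · exact ContDiff.sum fun k _ => contDiff_const.smul (hsω k)
  have hderiv : HasDerivAt (fun r => ckSeries hp v f₀ y r ω)
      (∑ k ∈ Finset.range d, (r ^ (2 * k + 1) / ((2 * k + 1)! : ℝ)) • (negLaplacian^[k + 1] f₀) y +
      ∑ k ∈ Finset.range d, (r ^ (2 * k) / ((2 * k)! : ℝ)) •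
        ((ω : A) * diracHead hp v (negLaplacian^[k] f₀) y)) r := by
    simp only [ckSeries_eq_sum hp hd]
    refine HasDerivAt.fun_add ?_ (HasDerivAt.fun_sum fun k _ =>
      (hasDerivAt_pow_div_factorial (2 * k) r).smul_const _)
    -- Index shift: the term `k = 0` is the constant `f₀ y`, and the new top term `k = d` vanishes
    -- since `(-Δ)^d f₀ = 0`.
    have h0 : ∀ r : ℝ, ∑ k ∈ Finset.range d, (r ^ (2 * k) / ((2 * k)! : ℝ)) •
        (negLaplacian^[k] f₀) y = ∑ k ∈ Finset.range d, (r ^ (2 * k + 1 + 1) /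
          ((2 * k + 1 + 1)! : ℝ)) • (negLaplacian^[k + 1] f₀) y + f₀ y := fun r => by
      have h := Finset.sum_range_succ' (fun k => (r ^ (2 * k) / ((2 * k)! : ℝ)) •
        (negLaplacian^[k] f₀) y) d
      rw [Finset.sum_range_succ, hd.negLaplacian_iterate le_rfl] at h
      have e : ∀ k, 2 * (k + 1) = 2 * k + 1 + 1 := fun k => by ring
      simpa [e] using h
    simp only [h0]
    exact (HasDerivAt.fun_sum fun k _ =>
      (hasDerivAt_pow_div_factorial (2 * k + 1) r).smul_const _).add_const _
  simp only [diracSlice]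
  rw [hderiv.deriv, hhead]
  simp only [mul_add, Finset.mul_sum, mul_smul_comm, hv.mul_mul_sphere hp hω, smul_neg,
    Finset.sum_neg_distrib]
  abel

lemma IsHypercomplexBasis.eq_on_slice [IsAlternativeRing A] [StarRing A]
    (hv : IsHypercomplexBasis v) {ω : M} (hω : ω ∈ unitSphere v p)
    {F G : (Fin (p + 1) → ℝ) × ℝ → A} (hF : ContDiff ℝ 1 F) (hG : ContDiff ℝ 1 G)
    (hDF : ∀ z, diracSlice hp v ω F z = 0) (hDG : ∀ z, diracSlice hp v ω G z = 0)
    (h0 : ∀ y, F (y, 0) = G (y, 0)) (y : Fin (p + 1) → ℝ) {r : ℝ} (hr : 0 ≤ r) :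
    F (y, r) = G (y, r) := by
  have : CompleteSpace A := FiniteDimensional.complete ℝ A
  have hFd := hF.differentiable one_ne_zero
  have hGd := hG.differentiable one_ne_zero
  refine sub_eq_zero.1 (eq_zero_of_cauchy_data (hv.factorsLaplacian hp hω)
    (H := fun z => F z - G z) (hF.sub hG) (fun z => ?_) (fun y => sub_eq_zero.2 (h0 y)) y hr)
  have h1 := hDF z
  have h2 := hDG z
  rw [diracSlice_eq_fderiv hp v ω hFd] at h1
  rw [diracSlice_eq_fderiv hp v ω hGd] at h2
  rw [fderiv_fun_sub (hFd z) (hGd z)]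
  simp only [_root_.sub_apply, map_sub, Finset.sum_sub_distrib]
  rw [sub_add_sub_comm]
  exact sub_eq_zero.2 (h1.trans h2.symm)

end Main

end PartialSlice

open PartialSlice in
theorem mainTheorem12 {A : Type*} [NormedNonAssocRing A] [NormedSpace ℝ A]
    [IsScalarTower ℝ A A] [SMulCommClass ℝ A A] [FiniteDimensional ℝ A]
    [IsAlternativeRing A] [StarRing A] [StarModule ℝ A]
    (M : Submodule ℝ A) (hM : PartialSlice.IsHypercomplexSubspace M)
    (m p : ℕ) (hp : p < m) (v : Module.Basis (Fin (m + 1)) ℝ M)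
    (hv : PartialSlice.IsHypercomplexBasis v)
    (f₀ : (Fin (p + 1) → ℝ) → A) (hf₀ : PartialSlice.IsPolynomialFun f₀) :
    (∀ (y : Fin (p + 1) → ℝ) (r : ℝ),
      Summable (PartialSlice.ckEvenTerm f₀ y r) ∧
      Summable (PartialSlice.ckOddTerm hp v f₀ y r)) ∧
    PartialSlice.IsGSM hp v ⊤ (PartialSlice.CK hp v f₀) ∧
    (∀ y, PartialSlice.CK hp v f₀ (PartialSlice.inclusion hp v y) = f₀ y) ∧
    (∀ g : M → A, PartialSlice.IsGSM hp v ⊤ g →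
      (∀ y, g (PartialSlice.inclusion hp v y) = f₀ y) → g = PartialSlice.CK hp v f₀) := by
  obtain ⟨d, hd⟩ := hf₀.isPolyLT
  have hslice : ∀ (ω : M) (y : Fin (p + 1) → ℝ), slicePoint hp v ω (y, 0) = inclusion hp v y :=
    fun ω y => by simp [slicePoint]
  have hCK : ∀ ω ∈ unitSphere v p, (fun z => CK hp v f₀ (slicePoint hp v ω z)) =
      fun z => ckSeries hp v f₀ z.1 z.2 ω := fun ω hω =>
    funext fun z => CK_slicePoint_real hp v f₀ z hω
  have hrestr : ∀ y, CK hp v f₀ (inclusion hp v y) = f₀ y := fun y => by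
    obtain ⟨ω, hω⟩ := exists_mem_unitSphere hp v
    rw [← hslice ω, CK_slicePoint_real hp v f₀ _ hω, ckSeries_zero]
  refine ⟨fun y r => ⟨?_, ?_⟩, fun ω hω => ?_, hrestr, fun g hg hg0 => funext fun x => ?_⟩
  · exact summable_of_ne_finset_zero (s := Finset.range d) fun k hk =>
      ckEvenTerm_eq_zero hd (by simpa using hk) y r
  · exact summable_of_ne_finset_zero (s := Finset.range d) fun k hk =>
      ckOddTerm_eq_zero hp hd (by simpa using hk) y r
  · rw [hCK ω hω]
    exact ⟨(contDiff_ckSeries hp hd ω).contDiffOn, fun z _ => hv.diracSlice_ckSeries hp hd hω z⟩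
  -- Uniqueness is local to one slice through `x`: `g` and the series have the same values at `r =
  -- 0` there.
  · obtain ⟨ω, hω, y, r, hr, rfl⟩ := exists_slicePoint_eq hp v x
    obtain ⟨hg1, hg2⟩ := hg ω hω
    have hu : {z | slicePoint hp v ω z ∈ (⊤ : TopologicalSpace.Opens M)} = Set.univ :=
      Set.eq_univ_of_forall fun _ => trivial
    rw [hu, contDiffOn_univ] at hg1
    rw [CK_slicePoint_real hp v f₀ _ hω]
    refine hv.eq_on_slice hp hω hg1 (contDiff_ckSeries hp hd ω) (fun z => hg2 z trivial)
      (hv.diracSlice_ckSeries hp hd hω) (fun y => ?_) y hr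
    rw [hslice, hg0, ckSeries_zero]
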